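/- **Setting.** Let $k\ge 1$ and let $X$ be a uniform metric space, $d(x,y)=\mathbb{I}(x\ne y)$, with a distinguished element $\bot\in X$ (the empty request). In the caching problem $\mathrm{CA}_{\boldsymbol S}$ (the $k$-server problem on $X$) with initial cache $\boldsymbol S=(S_1,\dots,S_k)\in X^k$, a request $e_t\in X$ arrives in each period $t=1,2,\dots$, and the decision maker, knowing $e_1,\dots,e_t$ and her past actions, chooses (possibly at random) a slot $a_t\in\{1,\dots,k\}$. This costs $d(e_t,x)$ if $e_t\neq\bot$ and $0$ if $e_t=\bot$, where $x$ is the current content of slot $a_t$; afterwards slot $a_t$ contains $e_t$. A sequence has *consecutive and finite support* if for some finite $M$ one has $e_t\ne\bot$ for $t\le M$ and $e_t=\bot$ for $t>M$. $\mathrm{Opt}(\mathrm{CA}_{\boldsymbol S},\boldsymbol e)$ is the minimum over all action sequences of the total cost on $\boldsymbol e$, and $\mathrm{Comp}(\mathrm{CA}_{\boldsymbol S},\boldsymbol e,\boldsymbol e^*,\pi)$ is the expected total cost on $\boldsymbol e$ of the algorithm $\pi$ that is given the prediction $\boldsymbol e^*$, divided by $\mathrm{Opt}(\mathrm{CA}_{\boldsymbol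 S},\boldsymbol e)$. **Marking algorithm** (started in some period with the current cache and no marks). If the requested item is in the cache, choose the first slot that holds it and mark it. Otherwise erase all marks if all slots are marked; then choose a uniformly random unmarked slot, load the item there and mark it. **AdaSwitch-CA** (with prediction $\boldsymbol e^*$). As long as the requested item is in the cache, choose the first slot that holds it. From the first cache miss on, that period included, run the following with $\eta=\epsilon=2(\ln k+1)$, $b=2$, $c=k$, beginning in the conservative state. * *Conservative*, entered at period $\tau$: choose $a_t$ by the Marking algorithm started at period $\tau$. Let $s$ be the minimum total cost of serving $e_\tau,\dots,e_t$ from the cache at the beginning of period $\tau$. If $s\ge 10(\eta+\epsilon)c/\epsilon$, become predictive from period $t+1$ on, with $\varphi=0$. * *Predictive*: let $a_t$ be the first action of any action sequence $a_t,a_{t+1},\dots$ that minimizes the total cost of serving $e_t,e^*_{t+1},e^*_{t+2},\dots$ from the current cache. Increase $\varphi$ by $\min(d(e_t,e_t^*),c/b)$. If $\varphi\ge 2(\eta+\epsilon)c/b$, become conservative from period $\tau=t+1$ on. **Theorem.** Let $\boldsymbol S\in X^k$, let the request sequence $\boldsymbol e$ and the prediction $\boldsymbol e^*$ have consecutive and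 finite support, and assume $\mathrm{Opt}(\mathrm{CA}_{\boldsymbol S},\boldsymbol e)>0$. Let $\varphi^*=\sum_{t\ge1}\mathbb{I}(e_t\ne e_t^*)$. Then, however the minimizers in the predictive state are chosen, $$\mathrm{Comp}(\mathrm{CA}_{\boldsymbol S},\boldsymbol e,\boldsymbol e^*,\text{AdaSwitch-CA})\le 1+\min\left(4(\ln k+1),\ \frac{56k(\ln k+1)+18\varphi^*}{\mathrm{Opt}(\mathrm{CA}_{\boldsymbol S},\boldsymbol e)}\right).$$ -/

import Mathlib

open scoped ENNReal

namespace AdaSwitch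

/-! Online cost minimization. Periods are numbered `0, 1, 2, …`. A history lists the pairs
(request, action) of the past periods, the most recent one first, so the period that follows the
history `h` has number `h.length`. -/

abbrev History (E A : Type*) := List (E × A)

/-- A problem with requests in `E` and actions in `A`: `cost h e a` is the cost of answering the
request `e` by the action `a` when `h` is the history of all earlier periods. -/
structure OnlineProblem (E A : Type*) where
  cost : History E A → E → A → ℝ≥0∞

/-- The history after `t` more periods with requests `e` and actions `a`, starting from `I`. -/
def extend {E A : Type*} (I : History E A) (e : ℕ → E) (a : ℕ → A) : ℕ → History E A
  | 0 => I
  | t + 1 => (e t, a t) :: extend I e a t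

namespace OnlineProblem

variable {E A : Type*} (P : OnlineProblem E A)

/-- Total cost of finitely many further periods after the history `I`. -/
def listVal : History E A → List (E × A) → ℝ≥0∞
  | _, [] => 0
  | I, (e, a) :: r => P.cost I e a + listVal ((e, a) :: I) r

/-- Hindsight optimal cost for the finite request list `es` after the history `I`. -/
noncomputable def listOpt (I : History E A) (es : List E) : ℝ≥0∞ :=
  ⨅ (as : List A) (_ : as.length = es.length), P.listVal I (es.zip as)

/-- Total cost of the action sequence `a` on the request sequence `e` after the history `I`. -/
noncomputable def val (I : History E A) (e : ℕ → E) (a : ℕ → A) : ℝ≥0∞ :=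
  ∑' t, P.cost (extend I e a t) (e t) (a t)

/-- Hindsight optimal cost for the request sequence `e`. -/
noncomputable def opt (e : ℕ → E) : ℝ≥0∞ :=
  ⨅ a : ℕ → A, P.val [] e a

end OnlineProblem

/-- A randomized online policy: the law of the next action, given the history and the current
request. -/
abbrev Policy (E A : Type*) := History E A → E → PMF A

/-- The law of the history of the first `t` periods when `π` is run on the request sequence `e`. -/
noncomputable def Policy.law {E A : Type*} (π : Policy E A) (e : ℕ → E) : ℕ → PMF (History E A)
  | 0 => PMF.pure []
  | t + 1 => (Policy.law π e t).bind fun h => (π h (e t)).map fun a => (e t, a) :: h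

/-- Expected total cost of the policy `π` on the request sequence `e`: the sum over all periods of
the expected cost of the period (the costs are nonnegative, so sum and expectation commute). -/
noncomputable def OnlineProblem.expectedVal {E A : Type*} (P : OnlineProblem E A) (e : ℕ → E)
    (π : Policy E A) : ℝ≥0∞ :=
  ∑' t, ∑' h, Policy.law π e t h * ∑' a, π h (e t) a * P.cost h (e t) a

/-- The competitive ratio of `π` on `e`. -/
noncomputable def OnlineProblem.comp {E A : Type*} (P : OnlineProblem E A) (e : ℕ → E)
    (π : Policy E A) : ℝ≥0∞ :=
  P.expectedVal e π / P.opt e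

/-! The meta-algorithm for cost minimization with a `1`-offline oracle. -/

/-- The state of the algorithm. `conservative I es`: the current conservative phase began after the
history `I`, and `es` are the requests seen since then, in order of arrival. `predictive φ`: the
prediction error accumulated in the current predictive phase is `φ`. -/
inductive Mode (E A : Type*) where
  | conservative (I : History E A) (es : List E) : Mode E A
  | predictive (φ : ℝ≥0∞) : Mode E A

/-- The request sequence made of the current request `e`, in period `t`, followed by the
predictions for the periods after `t`. -/
def splice {E : Type*} (e : E) (pred : ℕ → E) (t : ℕ) : ℕ → E
  | 0 => e
  | i + 1 => pred (t + i + 1)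

/-- The law of the next action. `online m` is the online oracle started after `m` periods;
`offline I e` is the action sequence computed by the offline oracle for the request sequence `e`
after the history `I`. -/
noncomputable def act {E A : Type*} (online : ℕ → Policy E A)
    (offline : History E A → (ℕ → E) → ℕ → A) (pred : ℕ → E) :
    Mode E A → Policy E A
  | .conservative I _, h, e => online I.length h e
  | .predictive _, h, e => PMF.pure (offline h (splice e pred h.length) 0)

open Classical in
/-- The state after the period with past `h`, request `e` and action `a`. Here `d` is the distance
of requests, `L` the bound on the cost of one period, `η` the ratio of the online oracle, `ε` the
slackness parameter, `b` and `c` the threshold parameters. -/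
noncomputable def step {E A : Type*} (P : OnlineProblem E A) (d : E → E → ℝ≥0∞)
    (L η ε b c : ℝ) (pred : ℕ → E) (h : History E A) (e : E) (a : A) : Mode E A → Mode E A
  | .conservative I es =>
      if ENNReal.ofReal (10 * (η + ε) * c * L / ε) ≤ P.listOpt I (es ++ [e]) then
        .predictive 0
      else .conservative I (es ++ [e])
  | .predictive φ =>
      if ENNReal.ofReal (2 * (η + ε) * c / b) ≤
          φ + min (d e (pred h.length)) (ENNReal.ofReal (c / b)) then
        .conservative ((e, a) :: h) []
      else .predictive (φ + min (d e (pred h.length)) (ENNReal.ofReal (c / b)))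

/-! The `k`-server problem and caching. -/

section KServer

variable {X : Type*} [MetricSpace X] [Bot X] {k : ℕ}

/-- The positions of the servers after the history `h`, from the initial positions `S`. -/
def config (S : Fin k → X) : History X (Fin k) → Fin k → X
  | [] => S
  | (e, a) :: h => Function.update (config S h) a e

open Classical in
/-- The `k`-server problem with initial positions `S`; `⊥` is the empty request. -/
noncomputable def kServer (S : Fin k → X) : OnlineProblem X (Fin k) where
  cost h e a := if e = ⊥ then 0 else edist e (config S h a)

/-- The nonempty requests are exactly those of the first `M` periods, for some finite `M`. -/
def ConsecutiveFiniteSupport (e : ℕ → X) : Prop :=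
  ∃ M : ℕ, (∀ i < M, e i ≠ ⊥) ∧ ∀ i, M ≤ i → e i = ⊥

/-- `offline` returns, after every history and for every request sequence with finitely many
nonempty requests, some action sequence of minimal cost. Ties are broken arbitrarily. -/
def IsOfflineOracle (S : Fin k → X)
    (offline : History X (Fin k) → (ℕ → X) → ℕ → Fin k) : Prop :=
  ∀ (I : History X (Fin k)) (e : ℕ → X), (∃ M : ℕ, ∀ i, M ≤ i → e i = ⊥) →
    ∀ a : ℕ → Fin k, (kServer S).val I e (offline I e) ≤ (kServer S).val I e a

open Classical in
/-- The cache slots that hold the item `e`. -/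
noncomputable def slots (C : Fin k → X) (e : X) : Finset (Fin k) :=
  Finset.univ.filter fun i => C i = e

open Classical in
/-- The set of marked slots after the history `h`, for the marking algorithm started with no marks
after the first `m` periods. A slot is marked when it serves a request; on a miss with all slots
marked, all marks are erased first. -/
noncomputable def marks (S : Fin k → X) (m : ℕ) : History X (Fin k) → Finset (Fin k)
  | [] => ∅
  | (e, a) :: h =>
      if h.length < m then ∅
      else if ¬ (slots (config S h) e).Nonempty ∧ marks S m h = Finset.univ then {a}
      else insert a (marks S m h)

open Classical in
/-- The slots that may be evicted on a miss, if the slots in `M` are marked. -/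
noncomputable def evictable (M : Finset (Fin k)) : Finset (Fin k) :=
  if M = Finset.univ then Finset.univ else Mᶜ

theorem evictable_nonempty [NeZero k] (M : Finset (Fin k)) : (evictable M).Nonempty := by
  unfold evictable
  split_ifs with h
  · exact ⟨0, Finset.mem_univ _⟩
  · rw [Finset.nonempty_iff_ne_empty]
    simpa using h

open Classical in
/-- The marking algorithm, started after `m` periods: a hit is served by the (first) slot that
holds the item, a miss evicts a uniformly random unmarked slot. -/
noncomputable def marking [NeZero k] (S : Fin k → X) (m : ℕ) : Policy X (Fin k) := fun h e =>
  if hit : (slots (config S h) e).Nonempty then PMF.pure ((slots (config S h) e).min' hit)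
  else PMF.uniformOfFinset (evictable (marks S m h)) (evictable_nonempty _)

/-- The competitive ratio of the marking algorithm that enters the thresholds. -/
noncomputable def etaCA (k : ℕ) : ℝ := 2 * (Real.log k + 1)

/-- The state update with `L = 1`, `η = ε = 2 (ln k + 1)`, `b = 2` and `c = k`. -/
noncomputable def stepCA (S : Fin k → X) (pred : ℕ → X) :
    History X (Fin k) → X → Fin k → Mode X (Fin k) → Mode X (Fin k) :=
  step (kServer S) edist 1 (etaCA k) (etaCA k) 2 k pred

open Classical in
/-- The state after the history `h`; `none` is the initial phase, which lasts until the first cache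
miss. The period of the first miss is the first period of the meta-algorithm. -/
noncomputable def modeCA (S : Fin k → X) (pred : ℕ → X) :
    History X (Fin k) → Option (Mode X (Fin k))
  | [] => none
  | (e, a) :: h =>
      match modeCA S pred h with
      | none =>
          if (slots (config S h) e).Nonempty then none
          else some (stepCA S pred h e a (.conservative h []))
      | some s => some (stepCA S pred h e a s)

open Classical in
/-- AdaSwitch-CA with prediction `pred`, as a randomized policy. -/
noncomputable def adaSwitchCA [NeZero k] (S : Fin k → X)
    (offline : History X (Fin k) → (ℕ → X) → ℕ → Fin k) (pred : ℕ → X) :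
    Policy X (Fin k) := fun h e =>
  match modeCA S pred h with
  | none =>
      if hit : (slots (config S h) e).Nonempty then PMF.pure ((slots (config S h) e).min' hit)
      else act (marking S) offline pred (.conservative h []) h e
  | some s => act (marking S) offline pred s h e

open Classical in
/-- The number of periods in which the prediction is wrong. -/
noncomputable def predictionErrors (e pred : ℕ → X) : ℝ≥0∞ :=
  ∑' i, if e i ≠ pred i then 1 else 0

end KServer

end AdaSwitch

/-! Write η = 2(ln k + 1). An optimal trajectory `D` of caches for the true requests is fixed, and
the expected cost to go of the algorithm is compared with that of `D` by backward induction. Two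
facts drive the comparison. (i) If two caches differ in m slots, their optimal costs differ by at
most m (`optCost_le_add_mismatch`). (ii) Marking costs in expectation at most η times the optimal
cost from the cache in which it starts (`value_marking_le`).

A completed conservative phase has optimal cost exactly 20k. So it costs at most 20ηk in expectation
by (ii), while `D` pays at least 19k by (i). In the predictive state the potential is the excess of
the optimal cost of the predicted remainder from the algorithm's cache over that from the cache of
`D`; by (i) it lies in [-k, k]. A wrong prediction shifts each of the two optimal costs by at most
2. Hence the cost of a period plus the change of the potential is at most the cost of `D` plus 4 per
wrong prediction (`predictive_step`).

Two accounts of the same induction (`IsBound.value_le`) give the two bounds. Robustness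
(`isBound_robust`): 1 + 2η times what `D` pays in a completed conservative phase covers that phase
and all errors tolerated in the next predictive phase. Consistency (`isBound_consistent`): the
errors that end a predictive phase pay for the next conservative phase, so only the first
conservative phase, 20ηk, stays unpaid.

Fact (ii) is the classical analysis by phases, which depend on the requests alone. The expected cost
is at most H_k per clean request (`value_marking_add_le`, by the survival probabilities of
`survival_le_value_held`), any trajectory pays at least half the number of clean requests
(`sum_clean_le`), and 2 H_k ≤ η. -/

namespace AdaSwitch

/-! ### Caches, request segments and trajectories -/

section Trajectories

variable {X : Type*} {k : ℕ}

open Classical in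
/-- The number of slots in which two caches differ. -/
noncomputable def mismatch (C D : Fin k → X) : ℕ :=
  (Finset.univ.filter fun i => C i ≠ D i).card

theorem mismatch_le (C D : Fin k → X) : mismatch C D ≤ k := by
  classical
  exact (Finset.card_filter_le _ _).trans (by simp)

theorem mismatch_self (C : Fin k → X) : mismatch C C = 0 := by simp [mismatch]

/-- The requests of the `n` periods that begin with period `t`. -/
def segment (e : ℕ → X) (t n : ℕ) : List X := (List.range' t n).map e

theorem segment_succ (e : ℕ → X) (t n : ℕ) :
    segment e t (n + 1) = e t :: segment e (t + 1) n := by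
  simp [segment, List.range'_succ]

theorem segment_concat (e : ℕ → X) (t n : ℕ) :
    segment e t (n + 1) = segment e t n ++ [e (t + n)] := by
  simp [segment, List.range'_1_concat]

/-- The caches `D` result from the actions `b` on the requests `e` in the periods from `t` up to
but excluding `u`. -/
def Follows (e : ℕ → X) (D : ℕ → Fin k → X) (b : ℕ → Fin k) (t u : ℕ) : Prop :=
  ∀ i, t ≤ i → i < u → D (i + 1) = Function.update (D i) (b i) (e i)

end Trajectories

/-! ### Hindsight optimal cost by dynamic programming -/

section OptCost

variable {X : Type*} [Bot X] {k : ℕ}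

open Classical in
/-- The cost of serving `x` by the slot `a` of the cache `C`. -/
noncomputable def missCost (C : Fin k → X) (x : X) (a : Fin k) : ℕ :=
  if x = ⊥ ∨ x = C a then 0 else 1

theorem missCost_le_one (C : Fin k → X) (x : X) (a : Fin k) : missCost C x a ≤ 1 := by
  unfold missCost; split_ifs <;> simp

/-- The least total cost of serving a list of requests from the cache `C`. -/
noncomputable def optCost [NeZero k] : (Fin k → X) → List X → ℕ
  | _, [] => 0
  | C, x :: r => Finset.univ.inf' Finset.univ_nonempty fun a =>
      missCost C x a + optCost (Function.update C a x) r

theorem optCost_cons_le [NeZero k] (C : Fin k → X) (x : X) (r : List X) (a : Fin k) :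
    optCost C (x :: r) ≤ missCost C x a + optCost (Function.update C a x) r :=
  Finset.inf'_le _ (Finset.mem_univ a)

theorem exists_optCost_cons_eq [NeZero k] (C : Fin k → X) (x : X) (r : List X) :
    ∃ a, optCost C (x :: r) = missCost C x a + optCost (Function.update C a x) r := by
  obtain ⟨a, -, h⟩ := Finset.exists_mem_eq_inf' (Finset.univ_nonempty (α := Fin k))
    fun a => missCost C x a + optCost (Function.update C a x) r
  exact ⟨a, h⟩

/-- Using the same slot in both caches makes them agree there. If they agreed before, the costs are
equal; otherwise the mismatch removed in slot `a` pays for a possible miss in `C`. -/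
theorem missCost_add_mismatch_update_le (C D : Fin k → X) (x : X) (a : Fin k) :
    missCost C x a + mismatch (Function.update C a x) (Function.update D a x) ≤
      missCost D x a + mismatch C D := by
  classical
  have hsub : (Finset.univ.filter fun i => Function.update C a x i ≠ Function.update D a x i) =
      (Finset.univ.filter fun i => C i ≠ D i).erase a := by
    ext i
    by_cases hi : i = a
    · subst hi; simp
    · simp [hi]
  by_cases h : C a = D a
  · have : missCost C x a = missCost D x a := by simp [missCost, h]
    rw [this, mismatch, mismatch, hsub]
    gcongr
    exact Finset.erase_subset _ _
  · have ha : a ∈ Finset.univ.filter fun i => C i ≠ D i := by simp [h]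
    have h1 := Finset.card_erase_add_one ha
    have h2 := missCost_le_one C x a
    rw [mismatch, mismatch, hsub]
    omega

/-- A nonempty request changes a slot only on a miss. The empty request is excluded because it
overwrites a slot for free. -/
theorem mismatch_update_right_le (C D : Fin k → X) {x : X} (hx : x ≠ ⊥) (a : Fin k) :
    mismatch C (Function.update D a x) ≤ mismatch C D + missCost D x a := by
  classical
  by_cases h : x = D a
  · subst h; simp
  · have h1 : missCost D x a = 1 := by simp [missCost, h, hx]
    rw [h1]
    refine (Finset.card_le_card ?_).trans (Finset.card_insert_le a _)
    intro i hi
    by_cases hia : i = a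
    · simp [hia]
    · simpa [hia] using hi

/-- Imitate from `C` the optimal actions from `D`, with the mismatch as potential. -/
theorem optCost_le_add_mismatch [NeZero k] (C D : Fin k → X) (r : List X) :
    optCost C r ≤ optCost D r + mismatch C D := by
  induction r generalizing C D with
  | nil => simp [optCost]
  | cons x r ih =>
    obtain ⟨a, ha⟩ := exists_optCost_cons_eq D x r
    have h1 := optCost_cons_le C x r a
    have h2 := ih (Function.update C a x) (Function.update D a x)
    have h3 := missCost_add_mismatch_update_le C D x a
    omega

/-- Keep the first action: it costs at most one more, and the resulting caches differ only in the
slot just used, which costs at most one more later. -/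
theorem optCost_cons_le_cons_add_two [NeZero k] (C : Fin k → X) (x y : X) (r : List X) :
    optCost C (x :: r) ≤ optCost C (y :: r) + 2 := by
  obtain ⟨a, ha⟩ := exists_optCost_cons_eq C y r
  have h1 := optCost_cons_le C x r a
  have h2 := optCost_le_add_mismatch (Function.update C a x) (Function.update C a y) r
  have h3 : mismatch (Function.update C a x) (Function.update C a y) ≤ 1 := by
    classical
    refine (Finset.card_le_card (t := {a}) ?_).trans (by simp)
    intro i hi
    by_contra hia
    have : i ≠ a := by simpa using hia
    simp [this] at hi
  have h4 := missCost_le_one C x a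
  omega

/-- Because of this unit growth, the optimal cost of a conservative phase meets its integer
threshold exactly. -/
theorem optCost_append_singleton_le [NeZero k] (C : Fin k → X) (r : List X) (x : X) :
    optCost C (r ++ [x]) ≤ optCost C r + 1 := by
  induction r generalizing C with
  | nil =>
    have h1 := optCost_cons_le C x [] 0
    have h2 := missCost_le_one C x 0
    simp only [optCost, List.nil_append] at *
    omega
  | cons y r ih =>
    obtain ⟨a, ha⟩ := exists_optCost_cons_eq C y r
    have h1 := optCost_cons_le C y (r ++ [x]) a
    have h2 := ih (Function.update C a y)
    rw [List.cons_append]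
    omega

theorem optCost_segment_le [NeZero k] {e : ℕ → X} {D : ℕ → Fin k → X} {b : ℕ → Fin k} {n t : ℕ}
    (hD : Follows e D b t (t + n)) :
    optCost (D t) (segment e t n) ≤ ∑ i ∈ Finset.Ico t (t + n), missCost (D i) (e i) (b i) := by
  induction n generalizing t with
  | zero => simp [segment, optCost]
  | succ n ih =>
    rw [Finset.sum_eq_sum_Ico_succ_bot (by omega), segment_succ]
    have h1 := optCost_cons_le (D t) (e t) (segment e (t + 1) n) (b t)
    rw [← hD t le_rfl (by omega)] at h1
    have h2 := ih (t := t + 1) fun i hi hi' => hD i (by omega) (by omega)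
    rw [show t + 1 + n = t + (n + 1) by omega] at h2
    omega

theorem exists_follows_optCost_eq [NeZero k] (e : ℕ → X) (n t : ℕ) (C : Fin k → X) :
    ∃ (D : ℕ → Fin k → X) (b : ℕ → Fin k), D t = C ∧ Follows e D b t (t + n) ∧
      ∑ i ∈ Finset.Ico t (t + n), missCost (D i) (e i) (b i) = optCost C (segment e t n) := by
  induction n generalizing t C with
  | zero => exact ⟨fun _ => C, fun _ => 0, rfl, fun i h h' => by omega, by simp [segment, optCost]⟩
  | succ n ih =>
    obtain ⟨a, ha⟩ := exists_optCost_cons_eq C (e t) (segment e (t + 1) n)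
    obtain ⟨D, b, hD, hF, hs⟩ := ih (t + 1) (Function.update C a (e t))
    refine ⟨fun i => if i ≤ t then C else D i, fun i => if i ≤ t then a else b i, by simp, ?_, ?_⟩
    · intro i h1 h2
      rcases h1.eq_or_lt with rfl | h1
      · simp [hD]
      · simpa [show ¬ i ≤ t by omega, show ¬ i + 1 ≤ t by omega] using hF i h1 (by omega)
    · rw [Finset.sum_eq_sum_Ico_succ_bot (by omega), segment_succ, ha, ← hs,
        show t + 1 + n = t + (n + 1) by omega]
      simp only [le_refl, if_true]
      congr 1
      refine Finset.sum_congr rfl fun i hi => ?_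
      rw [Finset.mem_Ico] at hi
      simp [show ¬ i ≤ t by omega]

end OptCost

/-! ### The online problem in terms of the combinatorial optimal cost -/

section ConfigTrajectories

variable {X : Type*} {k : ℕ}

theorem follows_extend (S : Fin k → X) (I : History X (Fin k)) (e : ℕ → X) (a : ℕ → Fin k)
    (t u : ℕ) : Follows e (fun i => config S (extend I e a i)) a t u :=
  fun _ _ _ => rfl

theorem Follows.eq_config_extend {S : Fin k → X} {I : History X (Fin k)} {e : ℕ → X}
    {D : ℕ → Fin k → X} {b : ℕ → Fin k} {u : ℕ} (hD : Follows e D b 0 u) (h0 : D 0 = config S I)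
    {i : ℕ} (hi : i ≤ u) : D i = config S (extend I e b i) := by
  induction i with
  | zero => exact h0
  | succ i ih => rw [hD i (by omega) (by omega), ih (by omega)]; rfl

end ConfigTrajectories

section Link

variable {X : Type*} [MetricSpace X] [Bot X] {k : ℕ}

theorem kServer_cost_eq (uniform : ∀ x y : X, x ≠ y → dist x y = 1) (S : Fin k → X)
    (h : History X (Fin k)) (x : X) (a : Fin k) :
    (kServer S).cost h x a = (missCost (config S h) x a : ℝ≥0∞) := by
  by_cases hx : x = ⊥
  · simp [kServer, missCost, hx]
  · by_cases hc : x = config S h a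
    · simp [kServer, missCost, ← hc]
    · simp [kServer, missCost, hc, hx, edist_dist, uniform x _ hc]

theorem val_eq_sum (uniform : ∀ x y : X, x ≠ y → dist x y = 1) (S : Fin k → X)
    (I : History X (Fin k)) {e : ℕ → X} {N : ℕ} (hN : ∀ i, N ≤ i → e i = ⊥) (a : ℕ → Fin k) :
    (kServer S).val I e a =
      ((∑ i ∈ Finset.Ico 0 N, missCost (config S (extend I e a i)) (e i) (a i) : ℕ) : ℝ≥0∞) := by
  rw [OnlineProblem.val, tsum_eq_sum (s := Finset.Ico 0 N)]
  · push_cast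
    exact Finset.sum_congr rfl fun i _ => kServer_cost_eq uniform S _ _ _
  · intro i hi
    simp [kServer, hN i (by simpa using hi)]

theorem opt_eq [NeZero k] (uniform : ∀ x y : X, x ≠ y → dist x y = 1) (S : Fin k → X) {e : ℕ → X}
    {N : ℕ} (hN : ∀ i, N ≤ i → e i = ⊥) :
    (kServer S).opt e = (optCost S (segment e 0 N) : ℝ≥0∞) := by
  apply le_antisymm
  · obtain ⟨D, b, h0, hF, hs⟩ := exists_follows_optCost_eq e N 0 S
    refine (iInf_le _ b).trans ?_
    rw [val_eq_sum uniform S [] hN, ← hs, zero_add]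
    refine le_of_eq (congrArg _ (Finset.sum_congr rfl fun i hi => ?_))
    rw [zero_add] at hF
    rw [hF.eq_config_extend (S := S) (I := []) h0 (Finset.mem_Ico.1 hi).2.le]
  · refine le_iInf fun a => ?_
    rw [val_eq_sum uniform S [] hN]
    have := optCost_segment_le (follows_extend S [] e a 0 (0 + N))
    rw [zero_add] at this
    exact_mod_cast this

theorem listOpt_eq [NeZero k] (uniform : ∀ x y : X, x ≠ y → dist x y = 1) (S : Fin k → X)
    (I : History X (Fin k)) (es : List X) :
    (kServer S).listOpt I es = (optCost (config S I) es : ℝ≥0∞) := by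
  apply le_antisymm
  · have key : ∃ as : List (Fin k), as.length = es.length ∧
        (kServer S).listVal I (es.zip as) = (optCost (config S I) es : ℝ≥0∞) := by
      induction es generalizing I with
      | nil => exact ⟨[], rfl, by simp [OnlineProblem.listVal, optCost]⟩
      | cons x es ih =>
        obtain ⟨a, ha⟩ := exists_optCost_cons_eq (config S I) x es
        obtain ⟨as, h1, h2⟩ := ih ((x, a) :: I)
        refine ⟨a :: as, by simp [h1], ?_⟩
        rw [List.zip_cons_cons, OnlineProblem.listVal, h2, kServer_cost_eq uniform, ha, config]
        push_cast
        rfl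
    obtain ⟨as, h1, h2⟩ := key
    exact (iInf₂_le as h1).trans h2.le
  · refine le_iInf₂ fun as has => ?_
    induction es generalizing I as with
    | nil => simp [optCost]
    | cons x es ih =>
      cases as with
      | nil => simp at has
      | cons a as =>
        rw [List.zip_cons_cons, OnlineProblem.listVal, kServer_cost_eq uniform]
        refine le_trans ?_ (add_le_add_right (ih ((x, a) :: I) as (by simpa using has)) _)
        exact_mod_cast optCost_cons_le (config S I) x es a

/-- Bellman inequality: the actions after the first one cost at least the optimum from the new
cache. The oracle is consulted anew in each period, so only its first action matters. -/
theorem IsOfflineOracle.missCost_add_optCost_le [NeZero k]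
    (uniform : ∀ x y : X, x ≠ y → dist x y = 1) {S : Fin k → X}
    {offline : History X (Fin k) → (ℕ → X) → ℕ → Fin k} (ho : IsOfflineOracle S offline)
    (I : History X (Fin k)) {f : ℕ → X} {N : ℕ} (hN : ∀ i, N + 1 ≤ i → f i = ⊥) :
    missCost (config S I) (f 0) (offline I f 0) +
        optCost (Function.update (config S I) (offline I f 0) (f 0)) (segment f 1 N) ≤
      optCost (config S I) (segment f 0 (N + 1)) := by
  obtain ⟨D, b, h0, hF, hs⟩ := exists_follows_optCost_eq f (N + 1) 0 (config S I)
  have h1 := ho I f ⟨N + 1, hN⟩ b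
  rw [val_eq_sum uniform S I hN, val_eq_sum uniform S I hN, Nat.cast_le,
    Finset.sum_eq_sum_Ico_succ_bot (Nat.succ_pos N)] at h1
  rw [← hs, zero_add]
  rw [zero_add] at hF
  have h2 : ∑ i ∈ Finset.Ico 0 (N + 1), missCost (D i) (f i) (b i) =
      ∑ i ∈ Finset.Ico 0 (N + 1), missCost (config S (extend I f b i)) (f i) (b i) :=
    Finset.sum_congr rfl fun i hi => by
      rw [hF.eq_config_extend (S := S) (I := I) h0 (Finset.mem_Ico.1 hi).2.le]
  rw [h2]
  refine le_trans ?_ h1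
  have h3 := optCost_segment_le (follows_extend S I f (offline I f) 1 (1 + N))
  rw [add_comm 1 N] at h3
  exact Nat.add_le_add_left h3 _

end Link

/-! ### Expected cost by backward recursion -/

section Expectation

variable {E A : Type*} [Fintype A]

theorem sum_toReal_pmf (p : PMF A) : ∑ a, (p a).toReal = 1 := by
  rw [← ENNReal.toReal_sum fun a _ => p.apply_ne_top a, ← tsum_fintype (L := .unconditional A),
    p.tsum_coe, ENNReal.toReal_one]

/-- The expected cost of a period with request `x`, plus the expectation of `f` at its end. -/
noncomputable def stepValue (π : Policy E A) (c : History E A → E → A → ℝ) (x : E)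
    (f : History E A → ℝ) (h : History E A) : ℝ :=
  ∑ a, (π h x a).toReal * (c h x a + f ((x, a) :: h))

/-- The expected cost of `n` periods from period `t` on, plus the expectation of `f` at their
end. -/
noncomputable def value (π : Policy E A) (c : History E A → E → A → ℝ) (e : ℕ → E) :
    ℕ → ℕ → (History E A → ℝ) → History E A → ℝ
  | 0, _, f => f
  | n + 1, t, f => stepValue π c (e t) (value π c e n (t + 1) f)

variable {π π' : Policy E A} {c : History E A → E → A → ℝ} {e : ℕ → E}

theorem stepValue_pure {x : E} {f : History E A → ℝ} {h : History E A} {a : A}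
    (ha : π h x = PMF.pure a) : stepValue π c x f h = c h x a + f ((x, a) :: h) := by
  classical
  rw [stepValue, Finset.sum_eq_single a]
  · simp [ha]
  · intro b _ hb
    simp [ha, PMF.pure_apply, hb]
  · simp

theorem value_add (π : Policy E A) (c : History E A → E → A → ℝ) (e : ℕ → E) (m n t : ℕ)
    (f : History E A → ℝ) :
    value π c e (m + n) t f = value π c e m t (value π c e n (t + m) f) := by
  induction m generalizing t with
  | zero => simp [value]
  | succ m ih =>
    rw [show m + 1 + n = m + n + 1 by omega, value, value, ih,
      show t + 1 + m = t + (m + 1) by omega]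

theorem value_succ (π : Policy E A) (c : History E A → E → A → ℝ) (e : ℕ → E) (n t : ℕ)
    (f : History E A → ℝ) :
    value π c e (n + 1) t f = value π c e n t (stepValue π c (e (t + n)) f) :=
  value_add π c e n 1 t f

theorem stepValue_add_const (x : E) (f : History E A → ℝ) (B : ℝ) :
    stepValue π c x (fun h => f h + B) = fun h => stepValue π c x f h + B := by
  ext h
  simp only [stepValue, ← add_assoc]
  simp only [mul_add _ _ B, Finset.sum_add_distrib, ← Finset.sum_mul, sum_toReal_pmf, one_mul]

theorem value_add_const (n t : ℕ) (f : History E A → ℝ) (B : ℝ) :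
    value π c e n t (fun h => f h + B) = fun h => value π c e n t f h + B := by
  induction n generalizing t with
  | zero => rfl
  | succ n ih => rw [value, ih, stepValue_add_const]; rfl

/-- With cost `0`, `value` is the plain expectation of `f`, so this is linearity of expectation. -/
theorem value_eq_value_zero_add (n t : ℕ) (f : History E A → ℝ) (h : History E A) :
    value π c e n t f h = value π c e n t 0 h + value π 0 e n t f h := by
  induction n generalizing t h with
  | zero => simp [value]
  | succ n ih =>
    simp only [value, stepValue, ih (t + 1)]
    simp only [Pi.zero_apply, zero_add, ← add_assoc]
    rw [← Finset.sum_add_distrib]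
    exact Finset.sum_congr rfl fun a _ => by ring

theorem value_zero_linear (n t : ℕ) (f g : History E A → ℝ) (r s : ℝ) (h : History E A) :
    value π 0 e n t (fun h => r * f h + s * g h) h =
      r * value π 0 e n t f h + s * value π 0 e n t g h := by
  induction n generalizing t h with
  | zero => rfl
  | succ n ih =>
    have : value π 0 e n (t + 1) (fun h => r * f h + s * g h) =
      fun h => r * value π 0 e n (t + 1) f h + s * value π 0 e n (t + 1) g h := funext (ih (t + 1))
    simp only [value, stepValue, this]
    rw [Finset.mul_sum, Finset.mul_sum, ← Finset.sum_add_distrib]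
    refine Finset.sum_congr rfl fun a _ => ?_
    simp only [Pi.zero_apply]
    ring

theorem stepValue_mono {x : E} {f g : History E A → ℝ} {h : History E A} (hπ : π h x = π' h x)
    (hfg : ∀ a, π h x a ≠ 0 → f ((x, a) :: h) ≤ g ((x, a) :: h)) :
    stepValue π c x f h ≤ stepValue π' c x g h := by
  refine Finset.sum_le_sum fun a _ => ?_
  rw [← hπ]
  by_cases ha : π h x a = 0
  · simp [ha]
  · have := hfg a ha
    gcongr

/-- Monotonicity of `value` for policies that agree as long as the invariant `Inv` holds. -/
theorem value_mono {Inv : ℕ → History E A → Prop} {n t : ℕ} {h₀ : History E A} (h0 : Inv 0 h₀)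
    (hstep : ∀ i < n, ∀ h, Inv i h → ∀ a, π h (e (t + i)) a ≠ 0 → Inv (i + 1) ((e (t + i), a) :: h))
    (hπ : ∀ i < n, ∀ h, Inv i h → π h (e (t + i)) = π' h (e (t + i)))
    {f g : History E A → ℝ} (hfg : ∀ h, Inv n h → f h ≤ g h) :
    value π c e n t f h₀ ≤ value π' c e n t g h₀ := by
  induction n generalizing f g with
  | zero => exact hfg _ h0
  | succ n ih =>
    rw [value_succ, value_succ]
    -- Peeling off the last period, rather than the first, lets the invariant be carried forward
    -- from `h₀`.
    refine ih (fun i hi => hstep i (by omega)) (fun i hi => hπ i (by omega)) fun h hh => ?_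
    exact stepValue_mono (hπ n (by omega) h hh) fun a ha =>
      hfg _ (hstep n (by omega) h hh a ha)

theorem value_const (n t : ℕ) (B : ℝ) (h : History E A) :
    value π 0 e n t (fun _ => B) h = B := by
  induction n generalizing t h with
  | zero => rfl
  | succ n ih =>
    simp only [value, stepValue, ih]
    simp [← Finset.sum_mul, sum_toReal_pmf]

/-- Connects the forward law of the history with the backward recursion, by splitting off the last
period on both sides. -/
theorem tsum_law_mul_ofReal (π : Policy E A) (e : ℕ → E) (t : ℕ) {f : History E A → ℝ}
    (hf : ∀ h, 0 ≤ f h) :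
    ∑' h, Policy.law π e t h * ENNReal.ofReal (f h) = ENNReal.ofReal (value π 0 e t 0 f []) := by
  induction t generalizing f with
  | zero =>
    rw [tsum_eq_single []]
    · simp [Policy.law, value]
    · intro h hh
      simp [Policy.law, PMF.pure_apply, hh]
  | succ t ih =>
    have hs : ∀ h, ENNReal.ofReal (stepValue π 0 (e t) f h) =
        ∑ a, π h (e t) a * ENNReal.ofReal (f ((e t, a) :: h)) := by
      intro h
      rw [stepValue, ENNReal.ofReal_sum_of_nonneg]
      · refine Finset.sum_congr rfl fun a _ => ?_
        rw [ENNReal.ofReal_mul ENNReal.toReal_nonneg, ENNReal.ofReal_toReal (PMF.apply_ne_top _ _)]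
        simp
      · intro a _
        exact mul_nonneg ENNReal.toReal_nonneg (by simpa using hf _)
    rw [value_succ, zero_add, ← ih]
    · simp only [hs, Policy.law, PMF.bind_apply, ← ENNReal.tsum_mul_right]
      rw [ENNReal.tsum_comm]
      refine tsum_congr fun h => ?_
      simp only [mul_assoc, ENNReal.tsum_mul_left]
      congr 1
      classical
      simp only [PMF.map_apply, ← ENNReal.tsum_mul_right]
      rw [ENNReal.tsum_comm, tsum_fintype]
      refine Finset.sum_congr rfl fun a _ => ?_
      rw [tsum_eq_single ((e t, a) :: h)]
      · simp
      · intro h' hh'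
        simp [hh']
    · intro h
      exact Finset.sum_nonneg fun a _ => mul_nonneg ENNReal.toReal_nonneg (by simpa using hf _)

theorem value_nonneg (hc : ∀ h x a, 0 ≤ c h x a) {f : History E A → ℝ} (hf : ∀ h, 0 ≤ f h)
    (n t : ℕ) (h : History E A) : 0 ≤ value π c e n t f h := by
  induction n generalizing t h with
  | zero => exact hf h
  | succ n ih =>
    exact Finset.sum_nonneg fun a _ =>
      mul_nonneg ENNReal.toReal_nonneg (add_nonneg (hc _ _ _) (ih _ _))

/-- If the costs vanish from period `M` on, the expected cost is that of the first `M` periods. -/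
theorem expectedVal_eq_ofReal_value (P : OnlineProblem E A) (hc : ∀ h x a, 0 ≤ c h x a)
    (hP : ∀ h x a, P.cost h x a = ENNReal.ofReal (c h x a)) {M : ℕ}
    (hM : ∀ t, M ≤ t → ∀ h a, P.cost h (e t) a = 0) :
    P.expectedVal e π = ENNReal.ofReal (value π c e M 0 0 []) := by
  have hs0 : ∀ t h, 0 ≤ stepValue π c (e t) 0 h := fun t h =>
    Finset.sum_nonneg fun a _ =>
      mul_nonneg ENNReal.toReal_nonneg (add_nonneg (hc _ _ _) le_rfl)
  have hterm : ∀ t, ∑' h, Policy.law π e t h * ∑' a, π h (e t) a * P.cost h (e t) a =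
      ENNReal.ofReal (value π 0 e t 0 (stepValue π c (e t) 0) []) := by
    intro t
    rw [← tsum_law_mul_ofReal π e t (hs0 t)]
    refine tsum_congr fun h => ?_
    congr 1
    rw [stepValue, ENNReal.ofReal_sum_of_nonneg, tsum_fintype]
    · refine Finset.sum_congr rfl fun a _ => ?_
      rw [ENNReal.ofReal_mul ENNReal.toReal_nonneg, ENNReal.ofReal_toReal (PMF.apply_ne_top _ _), hP]
      simp
    · intro a _
      exact mul_nonneg ENNReal.toReal_nonneg (add_nonneg (hc _ _ _) le_rfl)
  rw [OnlineProblem.expectedVal, tsum_eq_sum (s := Finset.range M)]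
  · simp only [hterm]
    clear hM
    induction M with
    | zero => simp [value]
    | succ M ih =>
      rw [Finset.sum_range_succ, ih, value_succ, zero_add,
        value_eq_value_zero_add (c := c) M 0 (stepValue π c (e M) 0) []]
      exact (ENNReal.ofReal_add (value_nonneg (f := 0) hc (fun _ => le_rfl) _ _ _)
        (value_nonneg (c := 0) (fun _ _ _ => le_rfl) (hs0 M) _ _ _)).symm
  · intro t ht
    simp [hM t (by simpa using ht)]

end Expectation

/-! ### Survival probabilities -/

section Survival

/-- The probability that `w` given elements of a set of size `q` all belong to a uniformly random
subset of size `n`. -/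
noncomputable def survival (n q w : ℕ) : ℝ := n.descFactorial w / q.descFactorial w

theorem survival_self {q w : ℕ} (h : w ≤ q) : survival q q w = 1 := by
  have : (q.descFactorial w : ℝ) ≠ 0 := by
    exact_mod_cast (mt Nat.descFactorial_eq_zero_iff_lt.1 (by omega))
  exact div_self this

theorem survival_one (n q : ℕ) : survival n q 1 = n / q := by simp [survival]

theorem sub_mul_descFactorial_succ (n w : ℕ) :
    ((n : ℝ) + 1 - w) * (n + 1).descFactorial w = (n + 1) * n.descFactorial w := by
  have h : (n + 1).descFactorial (w + 1) = (n + 1) * n.descFactorial w :=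
    Nat.succ_descFactorial_succ n w
  rw [Nat.descFactorial_succ] at h
  rcases le_or_gt w (n + 1) with hw | hw
  · have h' := congrArg (Nat.cast (R := ℝ)) h
    push_cast [Nat.cast_sub hw] at h'
    exact h'
  · rw [Nat.descFactorial_eq_zero_iff_lt.2 hw, Nat.descFactorial_eq_zero_iff_lt.2 (by omega)]
    simp

/-- A clean request evicts one of n + 1 unmarked slots; w given items escape with probability (n + 1
- w)/(n + 1). -/
theorem survival_succ (n q w : ℕ) :
    ((n : ℝ) + 1 - w) / (n + 1) * survival (n + 1) q w = survival n q w := by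
  have := sub_mul_descFactorial_succ n w
  rw [survival, survival, div_mul_div_comm, this, mul_div_mul_left _ _ (by positivity)]

/-- A request for a further one, x, of the q + 1 items: if x is held, nothing is evicted; otherwise
w held items survive with probability (n + 1 - w)/(n + 1). Weighting both cases gives the
coefficients of the events "w items held" and "w items and x held". -/
theorem survival_succ_succ (n : ℕ) {q w : ℕ} (hw : w ≤ q) :
    ((n : ℝ) + 1 - w) / (n + 1) * survival (n + 1) (q + 1) w +
      w / (n + 1) * survival (n + 1) (q + 1) (w + 1) = survival n q w := by
  rw [survival_succ]
  have hq : (q.descFactorial w : ℝ) ≠ 0 := by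
    exact_mod_cast (mt Nat.descFactorial_eq_zero_iff_lt.1 (by omega))
  have hq1 : ((q + 1).descFactorial w : ℝ) ≠ 0 := by
    exact_mod_cast (mt Nat.descFactorial_eq_zero_iff_lt.1 (by omega))
  have h1 := sub_mul_descFactorial_succ q w
  have hqw : (0 : ℝ) < q + 1 - w := by
    have : (w : ℝ) ≤ q := by exact_mod_cast hw
    linarith
  have h2 : (n + 1).descFactorial (w + 1) = (n + 1) * n.descFactorial w :=
    Nat.succ_descFactorial_succ n w
  have h3 : (q + 1).descFactorial (w + 1) = (q + 1) * q.descFactorial w :=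
    Nat.succ_descFactorial_succ q w
  have h4 : ((q + 1).descFactorial w : ℝ) = (q + 1) * q.descFactorial w / (q + 1 - w) := by
    rw [eq_div_iff hqw.ne', ← h1]; ring
  rw [survival, survival, survival, h2, h3, h4]
  push_cast
  field_simp
  ring

theorem survival_eq_zero {n w : ℕ} (q : ℕ) (h : n < w) : survival n q w = 0 := by
  rw [survival, Nat.descFactorial_eq_zero_iff_lt.2 h]; simp

end Survival

/-! ### Phases of the request sequence -/

section Phase

open scoped Classical

variable {X : Type*}

/-- A phase of the marking algorithm: the items that are in the cache when the phase begins, and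
the items that have been requested in the phase. -/
structure Phase (X : Type*) where
  start : Finset X
  requested : Finset X

/-- The phase after a further request. -/
noncomputable def Phase.next (k : ℕ) (p : Phase X) (x : X) : Phase X :=
  if x ∈ p.requested then p
  else if p.requested.card = k then ⟨p.requested, {x}⟩
  else ⟨p.start, insert x p.requested⟩

/-- `1` if the request is the first one of the phase for an item that is not in the cache when the
phase begins, and `0` otherwise. -/
noncomputable def Phase.clean (k : ℕ) (p : Phase X) (x : X) : ℕ :=
  if x ∈ p.requested then 0 else if p.requested.card = k then 1 else if x ∈ p.start then 0 else 1

/-- The phase after `n` requests from period `t` on, if the cache holds the items `P` first. -/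
noncomputable def phase (k : ℕ) (P : Finset X) (e : ℕ → X) (t : ℕ) : ℕ → Phase X
  | 0 => ⟨P, ∅⟩
  | n + 1 => (phase k P e t n).next k (e (t + n))

theorem phase_card_le {k : ℕ} (hk : 0 < k) {P : Finset X} (hP : P.card ≤ k) (e : ℕ → X) (t n : ℕ) :
    (phase k P e t n).start.card ≤ k ∧ (phase k P e t n).requested.card ≤ k := by
  induction n with
  | zero => simpa [phase] using hP
  | succ n ih =>
    rw [phase, Phase.next]
    split_ifs with h1 h2
    · exact ih
    · exact ⟨ih.2, by simpa using Nat.succ_le_of_lt hk⟩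
    · refine ⟨ih.1, (Finset.card_insert_le _ _).trans ?_⟩
      have := ih.2
      omega

end Phase

/-! ### The marking algorithm within a phase -/

section Marking

open scoped Classical

variable {X : Type*} {k : ℕ} {S : Fin k → X} {t : ℕ}
  {h : History X (Fin k)} {p : Phase X} {x : X}

/-- The marked slots are those that hold the items requested in the phase `p`, and each of them is
the first slot that holds its item. -/
structure MarkingInvariant (S : Fin k → X) (t : ℕ) (p : Phase X) (h : History X (Fin k)) :
    Prop where
  le_length : t ≤ h.length
  image_marks : (marks S t h).image (config S h) = p.requested
  le_of_eq : ∀ i ∈ marks S t h, ∀ j, config S h j = config S h i → i ≤ j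

theorem marks_of_length_eq (hl : h.length = t) : marks S t h = ∅ := by
  cases h with
  | nil => rfl
  | cons a h =>
    rw [marks, if_pos]
    rw [List.length_cons] at hl
    omega

theorem MarkingInvariant.init (hl : h.length = t) (P : Finset X) :
    MarkingInvariant S t ⟨P, ∅⟩ h := by
  have := marks_of_length_eq (S := S) hl
  exact ⟨hl.ge, by simp [this], by simp [this]⟩

namespace MarkingInvariant

variable (hp : MarkingInvariant S t p h)
include hp

/-- A marked slot is the first one with its item, so marked slots hold distinct items even if the
cache contains duplicates. -/
theorem card_marks : (marks S t h).card = p.requested.card := by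
  rw [← hp.image_marks, Finset.card_image_of_injOn]
  intro i hi j hj hij
  exact le_antisymm (hp.le_of_eq i hi j hij.symm) (hp.le_of_eq j hj i hij)

theorem mem_range_of_mem (hx : x ∈ p.requested) : ∃ i ∈ marks S t h, config S h i = x := by
  simpa [← hp.image_marks] using hx

theorem marks_eq_univ_iff : marks S t h = Finset.univ ↔ p.requested.card = k := by
  rw [← hp.card_marks, ← Finset.card_eq_iff_eq_univ, Fintype.card_fin]

theorem notMem_marks (hx : x ∉ p.requested) {i : Fin k} (hi : config S h i = x) :
    i ∉ marks S t h := fun hm => hx (by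
  rw [← hp.image_marks, ← hi]; exact Finset.mem_image_of_mem _ hm)

/-- Whatever the random choices, the set of marked items is a function of the requests alone. -/
theorem step [NeZero k] {a : Fin k} (ha : marking S t h x a ≠ 0) :
    MarkingInvariant S t (p.next k x) ((x, a) :: h) := by
  have hlen : ¬ h.length < t := not_lt.2 hp.le_length
  have hlen' : t ≤ ((x, a) :: h).length := hp.le_length.trans (by simp)
  by_cases hit : (slots (config S h) x).Nonempty
  · have ha' : a = (slots (config S h) x).min' hit := by
      by_contra hne
      simp [marking, hit, PMF.pure_apply, hne] at ha
    have hax : config S h a = x := by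
      have := Finset.min'_mem _ hit
      rw [← ha'] at this
      simpa [slots] using this
    have hmin : ∀ j, config S h j = x → a ≤ j := fun j hj => by
      rw [ha']; exact Finset.min'_le _ _ (by simpa [slots] using hj)
    have hconf : config S ((x, a) :: h) = config S h := by
      rw [config, ← hax, Function.update_eq_self]
    have hmarks : marks S t ((x, a) :: h) = insert a (marks S t h) := by
      simp [marks, hlen, hit]
    by_cases hx : x ∈ p.requested
    · obtain ⟨i, hi, hix⟩ := hp.mem_range_of_mem hx
      have hia : i = a := le_antisymm (hp.le_of_eq i hi a (hax.trans hix.symm)) (hmin i hix)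
      subst hia
      rw [Finset.insert_eq_self.2 hi] at hmarks
      rw [Phase.next, if_pos hx]
      exact ⟨hlen', by rw [hmarks, hconf, hp.image_marks],
        by rw [hmarks, hconf]; exact hp.le_of_eq⟩
    -- The slot of an item not yet requested in the phase is unmarked, so a hit never opens a new
    -- phase.
    · have hne : p.requested.card ≠ k := by
        rw [Ne, ← hp.marks_eq_univ_iff]
        intro hu
        exact hp.notMem_marks hx hax (hu ▸ Finset.mem_univ a)
      rw [Phase.next, if_neg hx, if_neg hne]
      refine ⟨hlen', by rw [hmarks, hconf, Finset.image_insert, hp.image_marks, hax], ?_⟩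
      rw [hmarks, hconf]
      intro i hi j hj
      rcases Finset.mem_insert.1 hi with rfl | hi
      · exact hmin j (hj.trans hax)
      · exact hp.le_of_eq i hi j hj
  · have hmiss : ∀ j, config S h j ≠ x := fun j hj =>
      hit ⟨j, by simpa [slots] using hj⟩
    have hx : x ∉ p.requested := fun hx => by
      obtain ⟨i, -, hi⟩ := hp.mem_range_of_mem hx
      exact hmiss i hi
    have hae : a ∈ evictable (marks S t h) := by
      by_contra hne
      simp [marking, hit, PMF.uniformOfFinset_apply, hne] at ha
    have hconf : config S ((x, a) :: h) = Function.update (config S h) a x := rfl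
    have hfirst : ∀ j, config S ((x, a) :: h) j = x → a ≤ j := fun j hj => by
      by_contra hja
      rw [hconf, Function.update_of_ne (by rintro rfl; exact hja le_rfl)] at hj
      exact hmiss j hj
    rw [Phase.next, if_neg hx]
    by_cases hu : marks S t h = Finset.univ
    · have hmarks : marks S t ((x, a) :: h) = {a} := by simp [marks, hlen, hit, hu]
      rw [if_pos (hp.marks_eq_univ_iff.1 hu)]
      refine ⟨hlen', by rw [hmarks, hconf]; simp, ?_⟩
      rw [hmarks]
      intro i hi j hj
      rw [Finset.mem_singleton.1 hi] at hj ⊢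
      exact hfirst j (by simpa [hconf] using hj)
    · have hmarks : marks S t ((x, a) :: h) = insert a (marks S t h) := by
        simp [marks, hlen, hu]
      have ham : a ∉ marks S t h := by simpa [evictable, hu] using hae
      rw [if_neg (mt hp.marks_eq_univ_iff.2 hu)]
      have hold : ∀ i ∈ marks S t h, config S ((x, a) :: h) i = config S h i := fun i hi => by
        rw [hconf, Function.update_of_ne (by rintro rfl; exact ham hi)]
      refine ⟨hlen', ?_, ?_⟩
      · rw [hmarks, Finset.image_insert, Finset.image_congr hold, hp.image_marks, hconf]
        simp
      · rw [hmarks]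
        intro i hi j hj
        rcases Finset.mem_insert.1 hi with rfl | hi
        · exact hfirst j (by simpa [hconf] using hj)
        · rw [hold i hi] at hj
          by_cases hja : j = a
          · subst hja
            rw [hconf, Function.update_self] at hj
            exact absurd hj.symm (hmiss i)
          · rw [hconf, Function.update_of_ne hja] at hj
            exact hp.le_of_eq i hi j hj

theorem card_evictable :
    (evictable (marks S t h)).card = if p.requested.card = k then k else k - p.requested.card := by
  by_cases hu : marks S t h = Finset.univ
  · rw [evictable, if_pos hu, if_pos (hp.marks_eq_univ_iff.1 hu), Finset.card_univ,
      Fintype.card_fin]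
  · rw [evictable, if_neg hu, if_neg (mt hp.marks_eq_univ_iff.2 hu), Finset.card_compl,
      Fintype.card_fin, hp.card_marks]

end MarkingInvariant

/-- The indicator of the event that all items of `W` are in the cache. -/
noncomputable def held (S : Fin k → X) (W : Finset X) (h : History X (Fin k)) : ℝ :=
  if ∀ w ∈ W, ∃ i, config S h i = w then 1 else 0

theorem held_nonneg (W : Finset X) : 0 ≤ held S W h := by
  unfold held; split_ifs <;> simp

theorem held_le_one (W : Finset X) : held S W h ≤ 1 := by
  unfold held; split_ifs <;> simp

theorem held_anti {V W : Finset X} (hVW : V ⊆ W) : held S W h ≤ held S V h := by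
  by_cases hW : ∀ w ∈ W, ∃ i, config S h i = w
  · rw [held, held, if_pos hW, if_pos fun w hw => hW w (hVW hw)]
  · rw [held, if_neg hW]; exact held_nonneg V

/-- The probability that given items survive a request served by the marking algorithm. -/
theorem le_stepValue_held [NeZero k] (S : Fin k → X) (t : ℕ) (h : History X (Fin k)) (x : X)
    (W : Finset X) {n : ℕ} (hn : (evictable (marks S t h)).card = n) :
    ((n : ℝ) - W.card) / n * held S W h + W.card / n * held S (insert x W) h ≤
      stepValue (marking S t) 0 x (held S W) h := by
  have hn0 : 0 < n := hn ▸ Finset.card_pos.2 (evictable_nonempty _)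
  have hnR : (0 : ℝ) < n := by exact_mod_cast hn0
  -- The two coefficients sum to 1. On a hit nothing is lost, which dominates any such average; on a
  -- miss the second term vanishes.
  by_cases hit : (slots (config S h) x).Nonempty
  · have hπ : marking S t h x = PMF.pure ((slots (config S h) x).min' hit) := by
      simp [marking, hit]
    rw [stepValue_pure hπ]
    have hmem := Finset.min'_mem _ hit
    set a := (slots (config S h) x).min' hit
    have hax : config S h a = x := by simpa [slots] using hmem
    have hconf : config S ((x, a) :: h) = config S h := by
      rw [config, ← hax, Function.update_eq_self]
    have : held S W ((x, a) :: h) = held S W h := by rw [held, held, hconf]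
    rw [this]
    calc _ ≤ ((n : ℝ) - W.card) / n * held S W h + W.card / n * held S W h := by
          gcongr
          exact held_anti (Finset.subset_insert _ _)
      _ = held S W h := by field_simp; ring
      _ = _ := by simp
  · have hx0 : held S (insert x W) h = 0 := by
      rw [held, if_neg]
      intro hall
      obtain ⟨i, hi⟩ := hall x (Finset.mem_insert_self _ _)
      exact hit ⟨i, by simpa [slots] using hi⟩
    have hπ : ∀ a, (marking S t h x a).toReal =
        if a ∈ evictable (marks S t h) then (n : ℝ)⁻¹ else 0 := by
      intro a
      rw [marking, dif_neg hit, PMF.uniformOfFinset_apply, hn]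
      split_ifs <;> simp
    rw [hx0, mul_zero, add_zero, stepValue]
    by_cases hW : ∀ w ∈ W, ∃ i, config S h i = w
    · rw [held, if_pos hW, mul_one]
      -- One slot per item of `W` suffices to hold `W`, so at most `W.card` of the `n` possible
      -- evictions are harmful.
      choose! g hg using hW
      have hsurv : ∀ a, a ∉ W.image g → held S W ((x, a) :: h) = 1 := by
        intro a ha
        rw [held, if_pos]
        intro w hw
        refine ⟨g w, ?_⟩
        rw [config, Function.update_of_ne, hg w hw]
        rintro rfl
        exact ha (Finset.mem_image_of_mem _ hw)
      calc ((n : ℝ) - W.card) / n ≤ ((evictable (marks S t h) \ W.image g).card : ℝ) / n := by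
            gcongr
            have h1 := Finset.le_card_sdiff (W.image g) (evictable (marks S t h))
            have h2 := Finset.card_image_le (s := W) (f := g)
            rw [hn] at h1
            have h3 : n ≤ (evictable (marks S t h) \ W.image g).card + W.card := by omega
            have : (n : ℝ) ≤ (evictable (marks S t h) \ W.image g).card + W.card := by
              exact_mod_cast h3
            linarith
        _ = ∑ a ∈ evictable (marks S t h) \ W.image g,
              (marking S t h x a).toReal * ((0 : ℝ) + held S W ((x, a) :: h)) := by
            rw [Finset.sum_congr rfl (g := fun _ => (n : ℝ)⁻¹), Finset.sum_const, nsmul_eq_mul,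
              div_eq_mul_inv]
            intro a ha
            rw [Finset.mem_sdiff] at ha
            rw [hsurv a ha.2, hπ, if_pos ha.1]
            ring
        _ ≤ _ := by
            refine Finset.sum_le_sum_of_subset_of_nonneg (Finset.subset_univ _) fun a _ _ => ?_
            exact mul_nonneg ENNReal.toReal_nonneg (by simpa using held_nonneg W)
    · rw [held, if_neg hW, mul_zero]
      exact Finset.sum_nonneg fun a _ =>
        mul_nonneg ENNReal.toReal_nonneg (by simpa using held_nonneg W)

end Marking

/-! ### Stale and fresh items of a phase -/

section PhaseCounts

open scoped Classical

variable {X : Type*} {k : ℕ} {p : Phase X} {x : X}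

/-- The number of requested items that were in the cache when the phase began. -/
noncomputable def Phase.stale (p : Phase X) : ℕ := (p.requested ∩ p.start).card

/-- The number of requested items that were not in the cache when the phase began. -/
noncomputable def Phase.fresh (p : Phase X) : ℕ := (p.requested \ p.start).card

theorem Phase.fresh_add_stale (p : Phase X) : p.fresh + p.stale = p.requested.card :=
  Finset.card_sdiff_add_card_inter _ _

theorem Phase.card_add_stale_le (p : Phase X) {W : Finset X} (hW : W ⊆ p.start \ p.requested) :
    W.card + p.stale ≤ p.start.card := by
  rw [Phase.stale, Finset.inter_comm, ← Finset.card_sdiff_add_card_inter p.start p.requested]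
  gcongr

theorem Phase.next_of_mem (hx : x ∈ p.requested) : p.next k x = p := if_pos hx

theorem Phase.next_of_card_eq (hx : x ∉ p.requested) (hc : p.requested.card = k) :
    p.next k x = ⟨p.requested, {x}⟩ := by
  rw [Phase.next, if_neg hx, if_pos hc]

theorem Phase.next_of_card_ne (hx : x ∉ p.requested) (hc : p.requested.card ≠ k) :
    p.next k x = ⟨p.start, insert x p.requested⟩ := by
  rw [Phase.next, if_neg hx, if_neg hc]

theorem Phase.stale_singleton (hx : x ∉ p.requested) : Phase.stale ⟨p.requested, {x}⟩ = 0 := by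
  simp [Phase.stale, hx]

theorem Phase.fresh_singleton (hx : x ∉ p.requested) : Phase.fresh ⟨p.requested, {x}⟩ = 1 := by
  rw [Phase.fresh, Finset.sdiff_eq_self_of_disjoint (by simpa using hx), Finset.card_singleton]

theorem Phase.stale_insert (hx : x ∉ p.requested) :
    Phase.stale ⟨p.start, insert x p.requested⟩ = p.stale + if x ∈ p.start then 1 else 0 := by
  unfold Phase.stale
  split_ifs with hs
  · rw [Finset.insert_inter_of_mem hs, Finset.card_insert_of_notMem (by simp [hx])]
  · rw [Finset.insert_inter_of_notMem hs, add_zero]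

theorem Phase.fresh_insert (hx : x ∉ p.requested) :
    Phase.fresh ⟨p.start, insert x p.requested⟩ = p.fresh + if x ∈ p.start then 0 else 1 := by
  unfold Phase.fresh
  split_ifs with hs
  · rw [Finset.insert_sdiff_of_mem _ hs, add_zero]
  · rw [Finset.insert_sdiff_of_notMem _ hs, Finset.card_insert_of_notMem (by simp [hx])]

end PhaseCounts

section Items

open scoped Classical

variable {X : Type*} {k : ℕ} {S : Fin k → X} {t : ℕ} {h : History X (Fin k)}

/-- The items in the cache `C`. -/
noncomputable def items (C : Fin k → X) : Finset X := Finset.univ.image C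

theorem mem_items {C : Fin k → X} {x : X} : x ∈ items C ↔ ∃ i, C i = x := by simp [items]

theorem card_sdiff_le_add (A B C : Finset X) : (A \ C).card ≤ (A \ B).card + (B \ C).card := by
  refine (Finset.card_le_card fun x => ?_).trans (Finset.card_union_le _ _)
  simp only [Finset.mem_sdiff, Finset.mem_union]
  tauto

theorem card_items_le (C : Fin k → X) : (items C).card ≤ k :=
  Finset.card_image_le.trans (by simp)

theorem MarkingInvariant.held_eq_one {p : Phase X} (hp : MarkingInvariant S t p h) {W : Finset X}
    (hW : W ⊆ p.requested) : held S W h = 1 := by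
  rw [held, if_pos]
  intro w hw
  obtain ⟨i, -, hi⟩ := hp.mem_range_of_mem (hW hw)
  exact ⟨i, hi⟩

end Items

/-! ### Survival of stale items under marking -/

section MarkingLaw

open scoped Classical

variable {X : Type*} {k : ℕ} [NeZero k] {S : Fin k → X} {t : ℕ} {h : History X (Fin k)}
  {P : Finset X} {e : ℕ → X}

theorem value_marking_mono (hl : h.length = t) {c : History X (Fin k) → X → Fin k → ℝ} {n : ℕ}
    {f g : History X (Fin k) → ℝ}
    (hfg : ∀ h', MarkingInvariant S t (phase k P e t n) h' → f h' ≤ g h') :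
    value (marking S t) c e n t f h ≤ value (marking S t) c e n t g h :=
  value_mono (Inv := fun i h' => MarkingInvariant S t (phase k P e t i) h')
    (MarkingInvariant.init hl P) (fun _ _ _ hi _ ha => hi.step ha) (fun _ _ _ _ => rfl) hfg

/-- The items that were in the cache when the phase began and have not been requested since are
jointly in the cache with at least the probability that they belong to a random subset. -/
theorem survival_le_value_held (hl : h.length = t) (hP : P = items (config S h)) (n : ℕ) {W : Finset X}
    (hW : W ⊆ (phase k P e t n).start \ (phase k P e t n).requested) :
    survival (k - (phase k P e t n).requested.card) (k - (phase k P e t n).stale) W.card ≤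
      value (marking S t) 0 e n t (held S W) h := by
  have hk : 0 < k := Nat.pos_of_ne_zero (NeZero.ne k)
  have hPk : P.card ≤ k := hP ▸ card_items_le _
  -- All `W` are treated at once: a request for `x` ties the survival of `W` to that of `insert x
  -- W`. There are `k - requested.card` unmarked slots, and at most `k - stale` initial items are
  -- still unrequested.
  induction n generalizing W with
  | zero =>
    have hWk : W.card ≤ k :=
      (Finset.card_le_card (hW.trans Finset.sdiff_subset)).trans hPk
    have h1 : (phase k P e t 0).requested.card = 0 := rfl
    have h2 : (phase k P e t 0).stale = 0 := by simp [phase, Phase.stale]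
    rw [h1, h2, Nat.sub_zero, survival_self hWk, value, held, if_pos]
    intro w hw
    exact mem_items.1 (hP ▸ (hW.trans Finset.sdiff_subset) hw)
  | succ n ih =>
    rw [value_succ]
    have hcard := phase_card_le hk hPk e t n
    have hnext : phase k P e t (n + 1) = (phase k P e t n).next k (e (t + n)) := rfl
    rw [hnext] at hW ⊢
    set p := phase k P e t n with hp
    set x := e (t + n) with hx
    by_cases hxR : x ∈ p.requested
    · rw [Phase.next_of_mem hxR] at hW ⊢
      refine (ih hW).trans (value_marking_mono (P := P) hl fun h' hh' => ?_)
      have hcar := Finset.card_pos.2 (evictable_nonempty (marks S t h'))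
      refine le_trans (le_of_eq ?_) (le_stepValue_held S t h' x W rfl)
      have : held S (insert x W) h' = held S W h' := by
        obtain ⟨i, -, hi⟩ := hh'.mem_range_of_mem hxR
        rw [held, held]
        congr 1
        simp only [Finset.forall_mem_insert, eq_iff_iff, and_iff_right_iff_imp]
        exact fun _ => ⟨i, hi⟩
      rw [this]
      field_simp
      ring
    · by_cases hc : p.requested.card = k
      · rw [Phase.next_of_card_eq hxR hc] at hW ⊢
        rw [Phase.stale_singleton hxR, Finset.card_singleton, Nat.sub_zero]
        have hWR : W ⊆ p.requested := hW.trans Finset.sdiff_subset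
        have hWk : W.card ≤ k := hc ▸ Finset.card_le_card hWR
        -- A new phase starts with all items of the old one surely in the cache, and one of `k`
        -- slots is evicted uniformly.
        have h1 : survival (k - 1) k W.card = ((k : ℝ) - W.card) / k := by
          obtain ⟨m, rfl⟩ : ∃ m, k = m + 1 := ⟨k - 1, by omega⟩
          rw [Nat.add_sub_cancel, ← survival_succ, survival_self hWk]
          push_cast
          ring
        rw [h1, ← value_const (π := marking S t) (e := e) n t (((k : ℝ) - W.card) / k) h]
        refine value_marking_mono (P := P) hl fun h' hh' => ?_
        have hE : (evictable (marks S t h')).card = k := by rw [hh'.card_evictable, if_pos hc]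
        refine le_trans ?_ (le_stepValue_held S t h' x W hE)
        rw [hh'.held_eq_one hWR, mul_one]
        exact le_add_of_nonneg_right (mul_nonneg (by positivity) (held_nonneg _))
      · rw [Phase.next_of_card_ne hxR hc] at hW ⊢
        have hWs := Phase.card_add_stale_le _ hW
        rw [Phase.stale_insert hxR] at hWs ⊢
        rw [Finset.card_insert_of_notMem hxR]
        simp only at hWs hW
        obtain ⟨m, hm⟩ : ∃ m, k - p.requested.card = m + 1 :=
          ⟨k - p.requested.card - 1, by omega⟩
        have hm' : k - (p.requested.card + 1) = m := by omega
        have hW' : W ⊆ p.start \ p.requested :=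
          hW.trans (Finset.sdiff_subset_sdiff le_rfl (Finset.subset_insert _ _))
        rw [hm']
        rcases lt_or_ge m W.card with hlt | hge
        · rw [survival_eq_zero _ hlt]
          exact value_nonneg (fun _ _ _ => le_rfl) (fun h' => Finset.sum_nonneg fun a _ =>
            mul_nonneg ENNReal.toReal_nonneg (by simpa using held_nonneg W)) _ _ _
        · have hstep : ∀ h', MarkingInvariant S t p h' →
              ((m : ℝ) + 1 - W.card) / (m + 1) * held S W h' +
                W.card / (m + 1) * held S (insert x W) h' ≤
              stepValue (marking S t) 0 x (held S W) h' := by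
            intro h' hh'
            have hE : (evictable (marks S t h')).card = m + 1 := by
              rw [hh'.card_evictable, if_neg hc, hm]
            have := le_stepValue_held S t h' x W hE
            push_cast at this
            exact this
          refine le_trans ?_ (value_marking_mono (P := P) hl hstep)
          rw [value_zero_linear]
          have hα : 0 ≤ ((m : ℝ) + 1 - W.card) / (m + 1) := by
            have : (W.card : ℝ) ≤ m := by exact_mod_cast hge
            apply div_nonneg <;> linarith
          have ih1 := ih hW'
          rw [hm] at ih1
          have hβ0 : 0 ≤ value (marking S t) 0 e n t (held S (insert x W)) h :=
            value_nonneg (fun _ _ _ => le_rfl) (fun _ => held_nonneg _) _ _ _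
          by_cases hs : x ∈ p.start
          · rw [if_pos hs] at hWs ⊢
            have hxW : x ∉ W := fun hxW => by simpa using hW hxW
            have hW2 : insert x W ⊆ p.start \ p.requested := by
              rw [Finset.insert_subset_iff]
              exact ⟨by simp [hs, hxR], hW'⟩
            have ih2 := ih hW2
            rw [hm, Finset.card_insert_of_notMem hxW] at ih2
            obtain ⟨q, hq⟩ : ∃ q, k - p.stale = q + 1 := ⟨k - p.stale - 1, by omega⟩
            rw [hq] at ih1 ih2
            rw [show k - (p.stale + 1) = q by omega, ← survival_succ_succ m (by omega)]
            gcongr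
          · rw [if_neg hs, add_zero, ← survival_succ]
            calc _ ≤ ((m : ℝ) + 1 - W.card) / (m + 1) *
                  value (marking S t) 0 e n t (held S W) h := by gcongr
              _ ≤ _ := le_add_of_nonneg_right (mul_nonneg (by positivity) hβ0)

end MarkingLaw

/-! ### Competitiveness of the marking algorithm -/

theorem monotone_harmonic : Monotone fun n : ℕ => (harmonic n : ℝ) :=
  monotone_nat_of_le_succ fun n => by
    rw [harmonic_succ]
    push_cast
    exact le_add_of_nonneg_right (by positivity)

section MarkingCost

open scoped Classical

variable {X : Type*} [Bot X] {k : ℕ} {S : Fin k → X} {t : ℕ} {h : History X (Fin k)}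
  {P : Finset X} {e : ℕ → X}

/-- The cost of a period, as a real number. -/
noncomputable def realCost (S : Fin k → X) (h : History X (Fin k)) (x : X) (a : Fin k) : ℝ :=
  missCost (config S h) x a

theorem realCost_nonneg (h : History X (Fin k)) (x : X) (a : Fin k) : 0 ≤ realCost S h x a :=
  Nat.cast_nonneg _

theorem stepValue_marking_le [NeZero k] (x : X) :
    stepValue (marking S t) (realCost S) x 0 h ≤ 1 - held S {x} h := by
  by_cases hit : (slots (config S h) x).Nonempty
  · have hπ : marking S t h x = PMF.pure ((slots (config S h) x).min' hit) := by
      simp [marking, hit]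
    rw [stepValue_pure hπ]
    have hmem := Finset.min'_mem _ hit
    set a := (slots (config S h) x).min' hit
    have hax : config S h a = x := by simpa [slots] using hmem
    have h0 : realCost S h x a = 0 := by simp [realCost, missCost, hax]
    have := held_le_one (S := S) (h := h) {x}
    rw [h0]
    simpa using this
  · have h0 : held S {x} h = 0 := by
      rw [held, if_neg]
      intro hall
      obtain ⟨i, hi⟩ := hall x (Finset.mem_singleton_self x)
      exact hit ⟨i, by simpa [slots] using hi⟩
    rw [h0, sub_zero, ← sum_toReal_pmf (marking S t h x)]
    refine Finset.sum_le_sum fun a _ => mul_le_of_le_one_right ENNReal.toReal_nonneg ?_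
    simpa [realCost] using missCost_le_one (config S h) x a

theorem value_marking_succ_le [NeZero k] (n : ℕ) :
    value (marking S t) (realCost S) e (n + 1) t 0 h ≤
      value (marking S t) (realCost S) e n t 0 h +
        (1 - value (marking S t) 0 e n t (held S {e (t + n)}) h) := by
  rw [value_succ, value_eq_value_zero_add]
  gcongr
  refine (value_mono (Inv := fun _ _ => True) trivial (fun _ _ _ _ _ _ => trivial)
    (fun _ _ _ _ => rfl) fun h' _ => stepValue_marking_le (S := S) (t := t) (e (t + n))).trans
      (le_of_eq ?_)
  have := value_zero_linear (π := marking S t) (e := e) n t (fun _ => 1) (held S {e (t + n)})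
    1 (-1) h
  rw [value_const] at this
  convert this using 1
  · congr 1
    ext h'
    ring
  · ring

/-- The expected cost of the marking algorithm is at most the harmonic number of the cache size
times the number of clean requests. -/
theorem value_marking_add_le [NeZero k] (hl : h.length = t) (hP : P = items (config S h)) (n : ℕ) :
    value (marking S t) (realCost S) e n t 0 h + (phase k P e t n).fresh *
        ((harmonic (k - (phase k P e t n).stale) : ℝ) - harmonic (phase k P e t n).fresh) ≤
      harmonic k * ∑ i ∈ Finset.range n, ((phase k P e t i).clean k (e (t + i)) : ℝ) := by
  have hk : 0 < k := Nat.pos_of_ne_zero (NeZero.ne k)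
  have hPk : P.card ≤ k := hP ▸ card_items_le _
  have hmono := monotone_harmonic
  -- The second summand on the left is a potential that prepays the misses on stale items still to
  -- come in the phase.
  induction n with
  | zero =>
    have h1 : (phase k P e t 0).fresh = 0 := by simp [phase, Phase.fresh]
    simp [value, h1]
  | succ n ih =>
    have hcard := phase_card_le hk hPk e t n
    have hsurv := survival_le_value_held (e := e) hl hP n (W := {e (t + n)})
    have hnext : phase k P e t (n + 1) = (phase k P e t n).next k (e (t + n)) := rfl
    have hsucc := value_marking_succ_le (S := S) (t := t) (e := e) (h := h) n
    rw [Finset.sum_range_succ, mul_add, hnext]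
    have hfs := (phase k P e t n).fresh_add_stale
    have hmem : ∀ h', MarkingInvariant S t (phase k P e t n) h' →
        e (t + n) ∈ (phase k P e t n).requested → held S {e (t + n)} h' = 1 :=
      fun h' hh' hx => hh'.held_eq_one (by simpa using hx)
    set p := phase k P e t n with hp
    set x := e (t + n) with hx
    by_cases hxR : x ∈ p.requested
    · have h1 : 1 ≤ value (marking S t) 0 e n t (held S {x}) h := by
        rw [← value_const (π := marking S t) (e := e) n t 1 h]
        exact value_marking_mono (P := P) hl fun h' hh' => (hmem h' hh' hxR).ge
      rw [Phase.next_of_mem hxR, Phase.clean, if_pos hxR]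
      push_cast
      linarith
    · have h0 : 0 ≤ value (marking S t) 0 e n t (held S {x}) h :=
        value_nonneg (fun _ _ _ => le_rfl) (fun _ => held_nonneg _) _ _ _
      by_cases hc : p.requested.card = k
      · rw [Phase.next_of_card_eq hxR hc, Phase.clean, if_neg hxR, if_pos hc,
          Phase.stale_singleton hxR, Phase.fresh_singleton hxR]
        -- In a complete phase fresh and stale items add up to `k`, so the potential is used up.
        have h1 : p.fresh * ((harmonic (k - p.stale) : ℝ) - harmonic p.fresh) = 0 := by
          rw [show k - p.stale = p.fresh by omega, sub_self, mul_zero]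
        have h2 : (harmonic 1 : ℝ) = 1 := by simp [harmonic]
        rw [h1] at ih
        rw [h2, Nat.sub_zero]
        push_cast
        linarith
      · rw [Phase.next_of_card_ne hxR hc, Phase.clean, if_neg hxR, if_neg hc,
          Phase.stale_insert hxR, Phase.fresh_insert hxR]
        by_cases hs : x ∈ p.start
        · rw [if_pos hs, if_pos hs, add_zero]
          have h1 := hsurv (by simp [hs, hxR])
          obtain ⟨q, hq⟩ : ∃ q, k - p.stale = q + 1 := ⟨k - p.stale - 1, by omega⟩
          rw [Finset.card_singleton, survival_one, hq,
            show k - p.requested.card = q + 1 - p.fresh by omega,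
            Nat.cast_sub (by omega)] at h1
          rw [hq, harmonic_succ] at ih
          rw [show k - (p.stale + 1) = q by omega]
          -- A stale item is missing with probability at most fresh/(q + 1), which is exactly the
          -- drop of the potential.
          have h2 : ((q + 1 : ℕ) - p.fresh : ℝ) / (q + 1 : ℕ) = 1 - p.fresh * (q + 1 : ℝ)⁻¹ := by
            push_cast
            field_simp
          rw [h2] at h1
          push_cast at ih ⊢
          linarith
        · rw [if_neg hs, if_neg hs]
          have h1 : (harmonic (k - p.stale) : ℝ) ≤ harmonic k := hmono (Nat.sub_le _ _)
          have h2 : (0 : ℝ) ≤ harmonic p.fresh := by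
            simpa using hmono (Nat.zero_le p.fresh)
          rw [harmonic_succ, add_zero]
          -- On a clean request the potential grows by H_{k - stale} - H_fresh - 1; with the miss
          -- itself this is at most H_k.
          have h3 : ((p.fresh : ℝ) + 1) * ((harmonic (k - p.stale) : ℝ) -
              (harmonic p.fresh + ((p.fresh : ℝ) + 1)⁻¹)) =
              p.fresh * ((harmonic (k - p.stale) : ℝ) - harmonic p.fresh) +
                harmonic (k - p.stale) - harmonic p.fresh - 1 := by
            field_simp
            ring
          push_cast
          rw [h3]
          linarith

/-- A cache that follows arbitrary actions pays for half of the clean requests of the marking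
algorithm that is started with the same cache. -/
theorem sum_clean_le [NeZero k] {D : ℕ → Fin k → X} {b : ℕ → Fin k} {n : ℕ} (hD : Follows e D b t (t + n))
    (hne : ∀ i, t ≤ i → i < t + n → e i ≠ ⊥) :
    ∑ i ∈ Finset.range n, (phase k (items (D t)) e t i).clean k (e (t + i)) ≤
      2 * ∑ i ∈ Finset.Ico t (t + n), missCost (D i) (e i) (b i) := by
  have hk : 0 < k := Nat.pos_of_ne_zero (NeZero.ne k)
  -- `A` is the set of items of `D` when the current phase begins; `o` and `o'` are the costs of `D`
  -- in the current phase and before it; `l` counts the clean requests of earlier phases. `D` has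
  -- paid `o` both for loading requested items outside `A` and for dropping requested items; the two
  -- bounds are used in consecutive phases, hence the factor 2.
  suffices hinv : ∃ (A : Finset X) (o o' l : ℕ),
      ∑ i ∈ Finset.Ico t (t + n), missCost (D i) (e i) (b i) = o' + o ∧
      ∑ i ∈ Finset.range n, (phase k (items (D t)) e t i).clean k (e (t + i)) =
        l + (phase k (items (D t)) e t n).fresh ∧
      l + (A \ (phase k (items (D t)) e t n).start).card ≤ 2 * o' ∧
      ((phase k (items (D t)) e t n).requested \ A).card ≤ o ∧
      ((phase k (items (D t)) e t n).requested \ items (D (t + n))).card ≤ o ∧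
      items (D (t + n)) ⊆ A ∪ (phase k (items (D t)) e t n).requested by
    obtain ⟨A, o, o', l, h1, h2, h3, h4, -, -⟩ := hinv
    have := card_sdiff_le_add (phase k (items (D t)) e t n).requested A
      (phase k (items (D t)) e t n).start
    rw [Phase.fresh] at h2
    omega
  induction n with
  | zero => exact ⟨items (D t), 0, 0, 0, by simp, by simp [phase, Phase.fresh], by simp [phase],
      by simp [phase], by simp [phase], by simp [phase]⟩
  | succ n ih =>
    obtain ⟨A, o, o', l, h1, h2, h3, h4, h5, h6⟩ :=
      ih (fun i hi hi' => hD i hi (by omega)) fun i hi hi' => hne i hi (by omega)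
    have hDn := hD (t + n) (by omega) (by omega)
    have hx0 := hne (t + n) (by omega) (by omega)
    have hnext : phase k (items (D t)) e t (n + 1) =
      (phase k (items (D t)) e t n).next k (e (t + n)) := rfl
    rw [← add_assoc, Finset.sum_Ico_succ_top (by omega), Finset.sum_range_succ, h1, h2, hnext]
    set p := phase k (items (D t)) e t n
    set x := e (t + n)
    set a := b (t + n)
    set C := D (t + n)
    set C' := D (t + n + 1)
    have hxC' : x ∈ items C' := mem_items.2 ⟨a, by rw [hDn, Function.update_self]⟩
    have hC'C : items C' ⊆ insert x (items C) := by
      intro y hy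
      obtain ⟨i, rfl⟩ := mem_items.1 hy
      by_cases hia : i = a
      · subst hia; rw [hDn]; simp
      · rw [hDn, Function.update_of_ne hia]
        exact Finset.mem_insert_of_mem (mem_items.2 ⟨i, rfl⟩)
    have hcost : (missCost C x a = 0 ∧ C' = C ∧ x ∈ items C) ∨ missCost C x a = 1 := by
      by_cases hxa : x = C a
      · exact Or.inl ⟨by simp [missCost, hxa], by rw [hDn, hxa, Function.update_eq_self],
          mem_items.2 ⟨a, hxa.symm⟩⟩
      · exact Or.inr (by simp [missCost, hxa, hx0])
    have hlost : ∀ R : Finset X,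
        (R \ items C').card ≤ (R \ items C).card + missCost C x a := by
      intro R
      rcases hcost with ⟨hc0, hCC, -⟩ | hc1
      · rw [hCC]; omega
      · rw [hc1]
        refine (Finset.card_le_card fun y hy => ?_).trans (Finset.card_insert_le (C a) _)
        rw [Finset.mem_sdiff] at hy
        by_cases hya : y = C a
        · exact Finset.mem_insert.2 (Or.inl hya)
        · refine Finset.mem_insert_of_mem (Finset.mem_sdiff.2 ⟨hy.1, fun hyC => hy.2 ?_⟩)
          obtain ⟨i, rfl⟩ := mem_items.1 hyC
          exact mem_items.2 ⟨i, by rw [hDn, Function.update_of_ne (by rintro rfl; exact hya rfl)]⟩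
    have hxlost : ∀ R : Finset X, (insert x R \ items C').card = (R \ items C').card := by
      intro R
      rw [Finset.insert_sdiff_of_mem _ hxC']
    by_cases hxR : x ∈ p.requested
    · rw [Phase.next_of_mem hxR, Phase.clean, if_pos hxR]
      refine ⟨A, o + missCost C x a, o', l, by omega, by omega, h3, by omega,
        (hlost _).trans (by omega), hC'C.trans ?_⟩
      rw [Finset.insert_subset_iff]
      exact ⟨Finset.mem_union_right _ hxR, h6⟩
    · by_cases hc : p.requested.card = k
      · rw [Phase.next_of_card_eq hxR hc, Phase.clean, if_neg hxR, if_pos hc,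
          Phase.fresh_singleton hxR]
        refine ⟨items C, missCost C x a, o' + o, l + p.fresh, rfl, rfl, ?_, ?_, ?_, ?_⟩
        -- As `items C` has at most `k` elements and `requested` exactly `k`, the set `items C \
        -- requested` is no larger than `requested \ items C`, so at most `o`. The fresh items are
        -- covered by `requested \ A`, again at most `o`, and `A \ start`.
        · have h7 := card_sdiff_le_add p.requested A p.start
          have h9 := Finset.card_sdiff_add_card_inter (items C) p.requested
          have h10 := Finset.card_sdiff_add_card_inter p.requested (items C)
          have h11 := card_items_le C
          rw [Finset.inter_comm] at h10
          rw [Phase.fresh]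
          simp only
          omega
        · rcases hcost with ⟨-, -, hxC⟩ | hc1
          · rw [Finset.sdiff_eq_empty_iff_subset.2 (by simpa using hxC)]; simp
          · rw [hc1]
            exact (Finset.card_le_card Finset.sdiff_subset).trans (by simp)
        · rw [Finset.sdiff_eq_empty_iff_subset.2 (by simpa using hxC')]; simp
        · rw [Finset.union_comm]
          exact hC'C
      · rw [Phase.next_of_card_ne hxR hc, Phase.clean, if_neg hxR, if_neg hc,
          Phase.fresh_insert hxR]
        refine ⟨A, o + missCost C x a, o', l, by omega, by split_ifs <;> omega, h3, ?_, ?_, ?_⟩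
        · rcases hcost with ⟨hc0, -, hxC⟩ | hc1
          -- An item that `D` holds and that was not requested in this phase has been there since
          -- the phase began.
          · have hxA : x ∈ A := (Finset.mem_union.1 (h6 hxC)).resolve_right hxR
            rw [Finset.insert_sdiff_of_mem _ hxA]
            omega
          · rw [hc1]
            have h7 : insert x p.requested \ A ⊆ insert x (p.requested \ A) := by
              intro y
              simp only [Finset.mem_sdiff, Finset.mem_insert]
              tauto
            have h8 := Finset.card_insert_le x (p.requested \ A)
            exact (Finset.card_le_card h7).trans (by omega)
        · simp only [hxlost]
          exact (hlost _).trans (by omega)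
        · refine hC'C.trans ?_
          rw [Finset.union_insert]
          exact Finset.insert_subset_insert _ h6

/-- The marking algorithm is `2 (ln k + 1)`-competitive. -/
theorem value_marking_le [NeZero k] (hl : h.length = t) (n : ℕ)
    (hne : ∀ i, t ≤ i → i < t + n → e i ≠ ⊥) :
    value (marking S t) (realCost S) e n t 0 h ≤
      etaCA k * optCost (config S h) (segment e t n) := by
  obtain ⟨D, b, h0, hF, hs⟩ := exists_follows_optCost_eq e n t (config S h)
  have h1 := sum_clean_le hF hne
  have h2 := value_marking_add_le (e := e) hl (P := items (D t)) (by rw [h0]) n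
  have hk : 0 < k := Nat.pos_of_ne_zero (NeZero.ne k)
  have hPk := phase_card_le hk (card_items_le (D t)) e t n
  have hmono := monotone_harmonic
  have hfs := (phase k (items (D t)) e t n).fresh_add_stale
  have h3 : (0 : ℝ) ≤ (phase k (items (D t)) e t n).fresh *
      ((harmonic (k - (phase k (items (D t)) e t n).stale) : ℝ) -
        harmonic (phase k (items (D t)) e t n).fresh) :=
    mul_nonneg (Nat.cast_nonneg _) (sub_nonneg.2 (hmono (by omega)))
  have h4 : (harmonic k : ℝ) ≤ 1 + Real.log k := harmonic_le_one_add_log k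
  have h5 : (0 : ℝ) ≤ harmonic k := by simpa using hmono (Nat.zero_le k)
  rw [hs] at h1
  have h6 : (∑ i ∈ Finset.range n, ((phase k (items (D t)) e t i).clean k (e (t + i)) : ℝ)) ≤
      2 * optCost (config S h) (segment e t n) := by exact_mod_cast h1
  calc _ ≤ (harmonic k : ℝ) * (2 * optCost (config S h) (segment e t n)) :=
        (le_trans (by linarith) h2).trans (mul_le_mul_of_nonneg_left h6 h5)
    _ ≤ (1 + Real.log k) * (2 * optCost (config S h) (segment e t n)) := by gcongr
    _ = _ := by rw [etaCA]; ring

end MarkingCost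

/-! ### Prediction errors and costs to go -/

theorem etaCA_ge_two {k : ℕ} [NeZero k] : 2 ≤ etaCA k := by
  have : 0 ≤ Real.log k := Real.log_natCast_nonneg k
  unfold etaCA
  linarith

section Errors

open scoped Classical

variable {X : Type*} {k : ℕ} {e pred : ℕ → X} {D : ℕ → Fin k → X} {b : ℕ → Fin k} {M t : ℕ}

/-- The prediction error of a request, scaled as in the predictive state. -/
noncomputable def scaledError (k : ℕ) (x y : X) : ℝ := if x = y then 0 else min 1 (k / 2)

/-- `1` if the prediction for period `t` is wrong, and `0` otherwise. -/
noncomputable def predictionError (e pred : ℕ → X) (t : ℕ) : ℕ := if e t = pred t then 0 else 1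

theorem optCost_cons_le_of_predictionError [Bot X] [NeZero k] (C : Fin k → X) (r : List X) :
    optCost C (e t :: r) ≤ optCost C (pred t :: r) + 2 * predictionError e pred t ∧
      optCost C (pred t :: r) ≤ optCost C (e t :: r) + 2 * predictionError e pred t := by
  unfold predictionError
  split_ifs with hx
  · rw [hx]; simp
  · exact ⟨optCost_cons_le_cons_add_two _ _ _ _, optCost_cons_le_cons_add_two _ _ _ _⟩

/-- The factor 2 is needed for `k = 1`, where a wrong prediction counts only 1/2. -/
theorem predictionError_le_two_mul_scaledError [NeZero k] (t : ℕ) :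
    (predictionError e pred t : ℝ) ≤ 2 * scaledError k (e t) (pred t) ∧
      scaledError k (e t) (pred t) ≤ predictionError e pred t ∧
      (predictionError e pred t : ℝ) ≤ 1 := by
  have hk : (1 : ℝ) ≤ k := by exact_mod_cast Nat.one_le_iff_ne_zero.2 (NeZero.ne k)
  unfold predictionError scaledError
  split_ifs
  · simp
  · refine ⟨?_, by simp, by simp⟩
    have : (1 : ℝ) / 2 ≤ min 1 (k / 2 : ℝ) := by apply le_min <;> linarith
    push_cast
    linarith

/-- The cost of the trajectory `D` in the periods from `t` up to but excluding `M`. -/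
noncomputable def costToGo [Bot X] (e : ℕ → X) (D : ℕ → Fin k → X) (b : ℕ → Fin k) (M t : ℕ) : ℕ :=
  ∑ i ∈ Finset.Ico t M, missCost (D i) (e i) (b i)

theorem costToGo_eq [Bot X] (ht : t < M) :
    costToGo e D b M t = missCost (D t) (e t) (b t) + costToGo e D b M (t + 1) :=
  Finset.sum_eq_sum_Ico_succ_bot ht _

/-- The number of wrong predictions in the periods from `t` up to but excluding `M`. -/
noncomputable def errorsToGo (e pred : ℕ → X) (M t : ℕ) : ℕ :=
  ∑ i ∈ Finset.Ico t M, predictionError e pred i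

theorem errorsToGo_eq (ht : t < M) :
    errorsToGo e pred M t = predictionError e pred t + errorsToGo e pred M (t + 1) :=
  Finset.sum_eq_sum_Ico_succ_bot ht _

end Errors

/-! ### The two states of AdaSwitch-CA -/

section AdaSwitchPhases

open scoped Classical

variable {X : Type*} [MetricSpace X] [Bot X] {k : ℕ} {S : Fin k → X}
  {offline : History X (Fin k) → (ℕ → X) → ℕ → Fin k} {e pred : ℕ → X}
  {h : History X (Fin k)} {x : X} {a : Fin k} {t : ℕ}

theorem stepCA_conservative [NeZero k] (uniform : ∀ x y : X, x ≠ y → dist x y = 1) (I : History X (Fin k))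
    (es : List X) :
    stepCA S pred h x a (.conservative I es) =
      if 20 * k ≤ optCost (config S I) (es ++ [x]) then .predictive 0
      else .conservative I (es ++ [x]) := by
  have hη := etaCA_ge_two (k := k)
  have h1 : ENNReal.ofReal (10 * (etaCA k + etaCA k) * k * 1 / etaCA k) = ((20 * k : ℕ) : ℝ≥0∞) := by
    rw [← ENNReal.ofReal_natCast]
    congr 1
    field_simp
    push_cast
    ring
  rw [stepCA, step, listOpt_eq uniform, h1]
  simp only [Nat.cast_le]

theorem stepCA_predictive (uniform : ∀ x y : X, x ≠ y → dist x y = 1) {φ : ℝ} (hφ : 0 ≤ φ) :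
    stepCA S pred h x a (.predictive (ENNReal.ofReal φ)) =
      if 2 * etaCA k * k ≤ φ + scaledError k x (pred h.length) then .conservative ((x, a) :: h) []
      else .predictive (ENNReal.ofReal (φ + scaledError k x (pred h.length))) := by
  have herr : 0 ≤ scaledError k x (pred h.length) := by
    unfold scaledError; split_ifs <;> positivity
  have h1 : min (edist x (pred h.length)) (ENNReal.ofReal (k / 2)) =
      ENNReal.ofReal (scaledError k x (pred h.length)) := by
    unfold scaledError
    split_ifs with hx
    · simp [hx]
    · rw [edist_dist, uniform _ _ hx, ENNReal.ofReal_min]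
  rw [stepCA, step, h1, ← ENNReal.ofReal_add hφ herr,
    show 2 * (etaCA k + etaCA k) * (k : ℝ) / 2 = 2 * etaCA k * k by ring]
  simp only [ENNReal.ofReal_le_ofReal_iff (add_nonneg hφ herr)]

/-- After the history `h`, a conservative phase begins with the request `x`. -/
def StartsConservative (S : Fin k → X) (pred : ℕ → X) (h : History X (Fin k)) (x : X) : Prop :=
  modeCA S pred h = some (.conservative h []) ∨
    modeCA S pred h = none ∧ ¬ (slots (config S h) x).Nonempty

theorem StartsConservative.adaSwitchCA_eq [NeZero k] (hs : StartsConservative S pred h x) :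
    adaSwitchCA S offline pred h x = marking S h.length h x := by
  rcases hs with hs | ⟨hs, hx⟩
  · simp [adaSwitchCA, hs, act]
  · simp [adaSwitchCA, hs, act, hx]

theorem StartsConservative.modeCA_cons (hs : StartsConservative S pred h x) :
    modeCA S pred ((x, a) :: h) = some (stepCA S pred h x a (.conservative h [])) := by
  rcases hs with hs | ⟨hs, hx⟩
  · simp [modeCA, hs]
  · simp [modeCA, hs, hx]

/-- As long as the optimal cost of a conservative phase is below the threshold, the algorithm
behaves like the marking algorithm. -/
theorem value_conservative_le [NeZero k] (uniform : ∀ x y : X, x ≠ y → dist x y = 1) (hl : h.length = t)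
    (hs : StartsConservative S pred h (e t)) {n : ℕ}
    (hlt : ∀ i < n, optCost (config S h) (segment e t i) < 20 * k)
    (hne : ∀ i, t ≤ i → i < t + n → e i ≠ ⊥) {f : History X (Fin k) → ℝ} {B : ℝ}
    (hf : ∀ h', h'.length = t + n → (0 < n → 20 * k ≤ optCost (config S h) (segment e t n) →
      modeCA S pred h' = some (.predictive 0)) → f h' ≤ B) :
    value (adaSwitchCA S offline pred) (realCost S) e n t f h ≤
      etaCA k * optCost (config S h) (segment e t n) + B := by
  have hmark := value_marking_le (S := S) (e := e) hl n hne
  refine le_trans ?_ (add_le_add_left hmark B)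
  have hconst := congrFun (value_add_const (π := marking S t) (c := realCost S) (e := e) n t 0 B) h
  rw [← hconst]
  -- At `i = 0` the state may still be `none`, if the phase starts at the first cache miss; this is
  -- why that case is recorded by `h' = h` and the state is described only for `0 < i`.
  refine value_mono (Inv := fun i h' => h'.length = t + i ∧ (i = 0 → h' = h) ∧
    (0 < i → modeCA S pred h' = some (if 20 * k ≤ optCost (config S h) (segment e t i) then
      .predictive 0 else .conservative h (segment e t i)))) ⟨hl, fun _ => rfl, by simp⟩ ?_ ?_ ?_
  · rintro i hi h' ⟨hl', h0, h1⟩ a -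
    refine ⟨by rw [List.length_cons, hl']; omega, by omega, fun _ => ?_⟩
    rcases Nat.eq_zero_or_pos i with rfl | hpos
    · obtain rfl := h0 rfl
      rw [add_zero, hs.modeCA_cons, stepCA_conservative uniform]
      rfl
    · have h1 := h1 hpos
      rw [if_neg (not_le.2 (hlt i hi))] at h1
      simp only [modeCA, h1]
      rw [stepCA_conservative uniform, ← segment_concat]
  · rintro i hi h' ⟨hl', h0, h1⟩
    rcases Nat.eq_zero_or_pos i with rfl | hpos
    · obtain rfl := h0 rfl
      rw [add_zero, hs.adaSwitchCA_eq, hl]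
    · have h1 := h1 hpos
      rw [if_neg (not_le.2 (hlt i hi))] at h1
      simp [adaSwitchCA, h1, act, hl]
  · rintro h' ⟨hl', -, h1⟩
    refine (hf h' hl' fun hn hle => ?_).trans_eq (by simp)
    rw [h1 hn, if_pos hle]

/-- The oracle's plan starts with the true current request; exchanging it for the predicted one
costs at most 2, and only if the prediction is wrong. -/
theorem predictive_step [NeZero k] (uniform : ∀ x y : X, x ≠ y → dist x y = 1)
    (ho : IsOfflineOracle S offline) {T : ℕ} (hT : ∀ i, T ≤ i → pred i = ⊥) (ht : t < T)
    (ha : a = offline h (splice (e t) pred t) 0) :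
    missCost (config S h) (e t) a +
        optCost (config S ((e t, a) :: h)) (segment pred (t + 1) (T - (t + 1))) ≤
      optCost (config S h) (segment pred t (T - t)) + 2 * predictionError e pred t := by
  obtain ⟨N, hN⟩ : ∃ N, T - t = N + 1 := ⟨T - t - 1, by omega⟩
  have h1 := ho.missCost_add_optCost_le uniform h (f := splice (e t) pred t) (N := N) (by
    intro i hi
    obtain ⟨j, rfl⟩ : ∃ j, i = j + 1 := ⟨i - 1, by omega⟩
    exact hT _ (by omega))
  have hseg : segment (splice (e t) pred t) 1 N = segment pred (t + 1) N := by
    rw [segment, segment, List.range'_eq_map_range, List.range'_eq_map_range, List.map_map,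
      List.map_map]
    refine List.map_congr_left fun i _ => ?_
    simp only [Function.comp_apply]
    rw [add_comm 1 i, splice]
    congr 1
    omega
  have h0 : splice (e t) pred t 0 = e t := rfl
  rw [segment_succ, zero_add, hseg, ← ha, h0] at h1
  rw [hN, show T - (t + 1) = N by omega, segment_succ, config]
  exact h1.trans (optCost_cons_le_of_predictionError _ _).1

end AdaSwitchPhases

/-! ### Backward induction and the two potential functions -/

section Analysis

open scoped Classical

variable {X : Type*} [Bot X] {k : ℕ} [NeZero k] {S : Fin k → X}
  {offline : History X (Fin k) → (ℕ → X) → ℕ → Fin k} {e pred : ℕ → X} {M : ℕ}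
  {D : ℕ → Fin k → X} {b : ℕ → Fin k}

/-- Bounds on the expected cost to go of AdaSwitch-CA against the trajectory `D`: `Bc t m` at the
beginning of a conservative phase, if the cache differs in `m` slots from `D t`, and `Bp t x φ` in
the predictive state with accumulated error `φ`, where `x` is the excess of the predicted cost to go
of the algorithm over that of `D`, shifted by `k` to be nonnegative. -/
structure IsBound (e pred : ℕ → X) (D : ℕ → Fin k → X) (b : ℕ → Fin k) (M : ℕ)
    (Bc : ℕ → ℕ → ℝ) (Bp : ℕ → ℝ → ℝ → ℝ) : Prop where
  final : ∀ x φ, 0 ≤ x → 0 ≤ φ → φ < 2 * etaCA k * k → 0 ≤ Bp M x φ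
  initial : ∀ t < M, ∀ m m', m' ≤ m + missCost (D t) (e t) (b t) → Bc (t + 1) m' ≤ Bc t m
  unfinished : ∀ t ≤ M, ∀ m s : ℕ, s ≤ 20 * k → s ≤ costToGo e D b M t + m → etaCA k * s ≤ Bc t m
  finished : ∀ t u, t ≤ u → u ≤ M → ∀ m ≤ k, 20 * k + costToGo e D b M u ≤ costToGo e D b M t + m →
    ∀ x : ℝ, x ≤ 2 * k → etaCA k * (20 * k) + Bp u x 0 ≤ Bc t m
  predictive : ∀ t < M, ∀ c x x' φ : ℝ, 0 ≤ φ →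
    c + x' ≤ missCost (D t) (e t) (b t) + x + 4 * predictionError e pred t →
      c + Bp (t + 1) x' (φ + scaledError k (e t) (pred t)) ≤ Bp t x φ
  conservative : ∀ t < M, ∀ c x x' φ : ℝ, φ < 2 * etaCA k * k →
    2 * etaCA k * k ≤ φ + scaledError k (e t) (pred t) → 0 ≤ x' →
    c + x' ≤ missCost (D t) (e t) (b t) + x + 4 * predictionError e pred t →
    ∀ m ≤ k, c + Bc (t + 1) m ≤ Bp t x φ

variable {Bc : ℕ → ℕ → ℝ} {Bp : ℕ → ℝ → ℝ → ℝ}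

/-- The induction is strong because a whole conservative phase is handled at once, by the marking
bound, whereas predictive periods are handled one by one. -/
theorem IsBound.value_le [MetricSpace X] (hB : IsBound e pred D b M Bc Bp)
    (uniform : ∀ x y : X, x ≠ y → dist x y = 1) (ho : IsOfflineOracle S offline)
    (hne : ∀ i < M, e i ≠ ⊥) {T : ℕ} (hT : ∀ i, T ≤ i → pred i = ⊥) (hMT : M ≤ T)
    (hD : Follows e D b 0 M) (n t : ℕ) (htn : t + n = M) (h : History X (Fin k))
    (hl : h.length = t) :
    (StartsConservative S pred h (e t) →
      value (adaSwitchCA S offline pred) (realCost S) e n t 0 h ≤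
        Bc t (mismatch (config S h) (D t))) ∧
    (∀ φ : ℝ, 0 ≤ φ → φ < 2 * etaCA k * k →
      modeCA S pred h = some (.predictive (ENNReal.ofReal φ)) →
      value (adaSwitchCA S offline pred) (realCost S) e n t 0 h ≤
        Bp t ((optCost (config S h) (segment pred t (T - t)) : ℝ) -
          optCost (D t) (segment pred t (T - t)) + k) φ) := by
  induction n using Nat.strong_induction_on generalizing t h with
  | _ n ih =>
  have hk : 0 < k := Nat.pos_of_ne_zero (NeZero.ne k)
  -- Caches differ in at most `k` slots, so the shifted excess lies between 0 and `2 * k`.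
  have hshift : ∀ (C : Fin k → X) (u : ℕ),
      0 ≤ (optCost C (segment pred u (T - u)) : ℝ) - optCost (D u) (segment pred u (T - u)) + k ∧
      (optCost C (segment pred u (T - u)) : ℝ) - optCost (D u) (segment pred u (T - u)) + k ≤
        2 * k := by
    intro C u
    have h1 := (optCost_le_add_mismatch C (D u) (segment pred u (T - u))).trans
      (Nat.add_le_add_left (mismatch_le _ _) _)
    have h2 := (optCost_le_add_mismatch (D u) C (segment pred u (T - u))).trans
      (Nat.add_le_add_left (mismatch_le _ _) _)
    have h1' : (optCost C (segment pred u (T - u)) : ℝ) ≤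
      optCost (D u) (segment pred u (T - u)) + k := by exact_mod_cast h1
    have h2' : (optCost (D u) (segment pred u (T - u)) : ℝ) ≤
      optCost C (segment pred u (T - u)) + k := by exact_mod_cast h2
    constructor <;> linarith
  constructor
  · intro hs
    -- `D` could serve the phase at its own cost, and the phase starts from a cache that differs
    -- from that of `D` only by the mismatch.
    have hphase : ∀ i ≤ n, optCost (config S h) (segment e t i) + costToGo e D b M (t + i) ≤
        costToGo e D b M t + mismatch (config S h) (D t) := by
      intro i hi
      have h1 := optCost_le_add_mismatch (config S h) (D t) (segment e t i)
      have h2 := optCost_segment_le (n := i) (t := t)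
        (fun j hj hj' => hD j (Nat.zero_le j) (by omega) : Follows e D b t (t + i))
      have h3 := Finset.sum_Ico_consecutive (fun j => missCost (D j) (e j) (b j))
        (show t ≤ t + i by omega) (show t + i ≤ M by omega)
      unfold costToGo
      omega
    by_cases hex : ∃ j, j ≤ n ∧ 20 * k ≤ optCost (config S h) (segment e t j)
    · have hj := Nat.find_spec hex
      have hmin := fun i => Nat.find_min hex (m := i)
      set j := Nat.find hex
      have hlt : ∀ i < j, optCost (config S h) (segment e t i) < 20 * k := fun i hi => by
        have := hmin i hi
        have := hj.1
        by_contra hcon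
        exact hmin i hi ⟨by omega, by omega⟩
      have hj0 : 0 < j := by
        by_contra hj0
        have h0 : j = 0 := by omega
        rw [h0] at hj
        simp only [segment, List.range'_zero, List.map_nil, optCost] at hj
        omega
      -- The optimal cost rises by at most one per request, so the threshold is not overshot.
      have hsj : optCost (config S h) (segment e t j) = 20 * k := by
        obtain ⟨i, hi⟩ : ∃ i, j = i + 1 := ⟨j - 1, by omega⟩
        have h1 := hlt i (by omega)
        have h2 := optCost_append_singleton_le (config S h) (segment e t i) (e (t + i))
        rw [← segment_concat, ← hi] at h2
        have := hj.2
        omega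
      have hfin := hB.finished t (t + j) (by omega) (by omega) _ (mismatch_le (config S h) (D t))
        (by have := hphase j hj.1; omega)
      rw [show n = j + (n - j) by omega, value_add]
      refine (value_conservative_le (B := Bc t (mismatch (config S h) (D t)) -
        etaCA k * (20 * k)) uniform hl hs hlt (fun i _ hi => hne i (by omega)) ?_).trans ?_
      · intro h' hl' hmode
        have h1 := (ih (n - j) (by omega) (t + j) (by omega) h' hl').2 0 le_rfl
          (by have := etaCA_ge_two (k := k); positivity)
          (by rw [hmode hj0 hj.2, ENNReal.ofReal_zero])
        have h2 := hfin _ (hshift (config S h') (t + j)).2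
        linarith
      · rw [hsj]
        push_cast
        linarith
    · push Not at hex
      refine (value_conservative_le (B := 0) uniform hl hs (fun i hi => hex i hi.le)
        (fun i _ hi => hne i (by omega)) fun _ _ _ => le_rfl).trans ?_
      rw [add_zero]
      exact hB.unfinished t (by omega) _ _ (hex n le_rfl).le
        (by have := hphase n le_rfl; omega)
  · intro φ hφ0 hφ hmode
    rcases Nat.eq_zero_or_pos n with rfl | hn
    · rw [add_zero] at htn
      subst htn
      exact hB.final _ _ (hshift _ _).1 hφ0 hφ
    · obtain ⟨m, rfl⟩ : ∃ m, n = m + 1 := ⟨n - 1, by omega⟩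
      have hπ : adaSwitchCA S offline pred h (e t) =
          PMF.pure (offline h (splice (e t) pred t) 0) := by
        simp [adaSwitchCA, hmode, act, hl]
      rw [value, stepValue_pure hπ]
      set a := offline h (splice (e t) pred t) 0 with ha
      have hl' : ((e t, a) :: h).length = t + 1 := by simp [hl]
      have ih' := ih m (by omega) (t + 1) (by omega) ((e t, a) :: h) hl'
      have h1 := predictive_step (e := e) uniform ho hT (show t < T by omega) ha
      -- For `D` the opposite estimate is needed: its predicted cost to go falls by at most its
      -- cost, plus 2 on a wrong prediction. With the 2 of the algorithm this makes 4.
      have h2 := optCost_cons_le (D t) (e t) (segment pred (t + 1) (T - (t + 1))) (b t)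
      rw [← hD t (Nat.zero_le t) (by omega)] at h2
      have h3 := (optCost_cons_le_of_predictionError (e := e) (pred := pred) (t := t) (D t)
        (segment pred (t + 1) (T - (t + 1)))).2
      rw [← segment_succ, show T - (t + 1) + 1 = T - t by omega] at h3
      have h4 : realCost S h (e t) a +
          ((optCost (config S ((e t, a) :: h)) (segment pred (t + 1) (T - (t + 1))) : ℝ) -
            optCost (D (t + 1)) (segment pred (t + 1) (T - (t + 1))) + k) ≤
          missCost (D t) (e t) (b t) +
            ((optCost (config S h) (segment pred t (T - t)) : ℝ) -
              optCost (D t) (segment pred t (T - t)) + k) + 4 * predictionError e pred t := by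
        have h1' := (Nat.cast_le (α := ℝ)).2 h1
        have h2' := (Nat.cast_le (α := ℝ)).2 h2
        have h3' := (Nat.cast_le (α := ℝ)).2 h3
        push_cast at h1' h2' h3'
        rw [realCost]
        linarith
      have hnext : modeCA S pred ((e t, a) :: h) =
          some (stepCA S pred h (e t) a (.predictive (ENNReal.ofReal φ))) := by
        simp [modeCA, hmode]
      rw [stepCA_predictive uniform hφ0, hl] at hnext
      have herr : 0 ≤ scaledError k (e t) (pred t) := by
        unfold scaledError; split_ifs <;> positivity
      by_cases hswitch : 2 * etaCA k * k ≤ φ + scaledError k (e t) (pred t)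
      · rw [if_pos hswitch] at hnext
        refine le_trans (add_le_add_right (ih'.1 (Or.inl hnext)) _) ?_
        exact hB.conservative t (by omega) _ _ _ _ hφ hswitch
          (hshift (config S ((e t, a) :: h)) (t + 1)).1 h4 _ (mismatch_le _ _)
      · rw [if_neg hswitch] at hnext
        refine le_trans (add_le_add_right (ih'.2 _ (by positivity) (not_le.1 hswitch) hnext) _) ?_
        exact hB.predictive t (by omega) _ _ _ _ hφ0 h4

/-- Before the first miss the cache remains `S` while `D` may move away; the misses of `D` pay for
the growing mismatch. -/
theorem IsBound.value_initial_le [MetricSpace X] (hB : IsBound e pred D b M Bc Bp)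
    (uniform : ∀ x y : X, x ≠ y → dist x y = 1) (ho : IsOfflineOracle S offline)
    (hne : ∀ i < M, e i ≠ ⊥) {T : ℕ} (hT : ∀ i, T ≤ i → pred i = ⊥) (hMT : M ≤ T)
    (hD : Follows e D b 0 M) (n t : ℕ) (htn : t + n = M) (h : History X (Fin k))
    (hl : h.length = t) (hmode : modeCA S pred h = none) (hS : config S h = S) :
    value (adaSwitchCA S offline pred) (realCost S) e n t 0 h ≤ Bc t (mismatch S (D t)) := by
  induction n generalizing t h with
  | zero =>
    have := hB.unfinished t (by omega) (mismatch S (D t)) 0 (Nat.zero_le _) (Nat.zero_le _)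
    simpa [value] using this
  | succ n ih =>
    by_cases hit : (slots (config S h) (e t)).Nonempty
    · have hπ : adaSwitchCA S offline pred h (e t) =
          PMF.pure ((slots (config S h) (e t)).min' hit) := by
        simp [adaSwitchCA, hmode, hit]
      rw [value, stepValue_pure hπ]
      have hmem := Finset.min'_mem _ hit
      set a := (slots (config S h) (e t)).min' hit
      have hax : config S h a = e t := by simpa [slots] using hmem
      have h0 : realCost S h (e t) a = 0 := by simp [realCost, missCost, hax]
      rw [h0, zero_add]
      refine (ih (t + 1) (by omega) ((e t, a) :: h) (by simp [hl]) (by simp [modeCA, hmode, hit])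
        ?_).trans (hB.initial t (by omega) _ _ ?_)
      · rw [config, ← hax, Function.update_eq_self, hS]
      · rw [hD t (Nat.zero_le t) (by omega)]
        exact mismatch_update_right_le _ _ (hne t (by omega)) _
    · have := (hB.value_le uniform ho hne hT hMT hD (n + 1) t htn h hl).1 (Or.inr ⟨hmode, hit⟩)
      rwa [hS] at this

/-- In `Bp` the term `8 * (2 * etaCA k * k + 1 - φ)` is the error budget left: a wrong prediction
costs 4, at most 8 per unit of scaled error, and the `+ 1` covers the period in which `φ` crosses
its threshold. The term `etaCA k * k` pays for the mismatch at the next conservative start. Both are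
funded by the 20k of optimal cost of a completed conservative phase, taken with factor 1 + 2η: about
40ηk, against 20ηk for marking and 17ηk for these reserves. -/
theorem isBound_robust : IsBound e pred D b M
    (fun t m => (1 + 2 * etaCA k) * costToGo e D b M t + etaCA k * m)
    (fun t x φ => (1 + 2 * etaCA k) * costToGo e D b M t + x +
      8 * (2 * etaCA k * k + 1 - φ) + etaCA k * k) := by
  have hη := etaCA_ge_two (k := k)
  have hk : (1 : ℝ) ≤ k := by exact_mod_cast Nat.one_le_iff_ne_zero.2 (NeZero.ne k)
  have hηk : 0 ≤ etaCA k * k := by positivity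
  constructor
  · intro x φ hx hφ0 hφ
    have : (0 : ℝ) ≤ (1 + 2 * etaCA k) * costToGo e D b M M := by positivity
    linarith
  · intro t ht m m' hm
    rw [costToGo_eq ht]
    have hm' : (m' : ℝ) ≤ m + missCost (D t) (e t) (b t) := by exact_mod_cast hm
    have h1 := mul_le_mul_of_nonneg_left hm' (by linarith : 0 ≤ etaCA k)
    have h2 : (0 : ℝ) ≤ (1 + etaCA k) * missCost (D t) (e t) (b t) := by positivity
    push_cast
    linarith
  · intro t _ m s _ hs
    have hs' : (s : ℝ) ≤ costToGo e D b M t + m := by exact_mod_cast hs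
    have h1 := mul_le_mul_of_nonneg_left hs' (by linarith : 0 ≤ etaCA k)
    have h2 : (0 : ℝ) ≤ (1 + etaCA k) * costToGo e D b M t := by positivity
    linarith
  · intro t u _ _ m hm hs x hx
    have hs' : (20 * k : ℝ) + costToGo e D b M u ≤ costToGo e D b M t + m := by exact_mod_cast hs
    have hm' : (m : ℝ) ≤ k := by exact_mod_cast hm
    have h1 := mul_le_mul_of_nonneg_left hs' (by linarith : 0 ≤ 1 + 2 * etaCA k)
    have h2 := mul_le_mul_of_nonneg_left hm' (by linarith : 0 ≤ 1 + etaCA k)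
    linarith
  · intro t ht c x x' φ _ hc
    obtain ⟨h1, -, -⟩ := predictionError_le_two_mul_scaledError (e := e) (pred := pred) (k := k) t
    have h2 : (0 : ℝ) ≤ 2 * etaCA k * missCost (D t) (e t) (b t) := by positivity
    rw [costToGo_eq ht]
    push_cast
    linarith
  · intro t ht c x x' φ hφ _ hx' hc m hm
    obtain ⟨-, -, h1⟩ := predictionError_le_two_mul_scaledError (e := e) (pred := pred) (k := k) t
    have h2 : (0 : ℝ) ≤ 2 * etaCA k * missCost (D t) (e t) (b t) := by positivity
    have hm' : (m : ℝ) ≤ k := by exact_mod_cast hm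
    have h3 := mul_le_mul_of_nonneg_left hm' (by linarith : 0 ≤ etaCA k)
    rw [costToGo_eq ht]
    push_cast
    linarith

/-- A wrong prediction costs 4 and adds at most 10 to `10 * φ`, hence 14 per error. At the switch
`10 * φ` has reached 10 · 2ηk = 20ηk, the price of the next conservative phase. At the end of that
phase the excess, at most `2 * k`, is covered by the 19k or more that `D` has paid. -/
theorem isBound_consistent : IsBound e pred D b M
    (fun t _ => costToGo e D b M t + 20 * (etaCA k * k) + 14 * errorsToGo e pred M t)
    (fun t x φ => costToGo e D b M t + x + 14 * errorsToGo e pred M t + 10 * φ) := by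
  have hη := etaCA_ge_two (k := k)
  have hk : (1 : ℝ) ≤ k := by exact_mod_cast Nat.one_le_iff_ne_zero.2 (NeZero.ne k)
  constructor
  · intro x φ hx hφ0 _
    positivity
  · intro t ht m m' hm
    rw [costToGo_eq ht, errorsToGo_eq ht]
    have h1 : (0 : ℝ) ≤ missCost (D t) (e t) (b t) := Nat.cast_nonneg _
    have h2 : (0 : ℝ) ≤ predictionError e pred t := Nat.cast_nonneg _
    push_cast
    linarith
  · intro t _ m s hs _
    have hs' : (s : ℝ) ≤ 20 * k := by exact_mod_cast hs
    have h1 := mul_le_mul_of_nonneg_left hs' (by linarith : 0 ≤ etaCA k)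
    have h2 : (0 : ℝ) ≤ costToGo e D b M t := Nat.cast_nonneg _
    have h3 : (0 : ℝ) ≤ errorsToGo e pred M t := Nat.cast_nonneg _
    linarith
  · intro t u htu _ m hm hs x hx
    have hs' : (20 * k : ℝ) + costToGo e D b M u ≤ costToGo e D b M t + m := by exact_mod_cast hs
    have hm' : (m : ℝ) ≤ k := by exact_mod_cast hm
    have h1 : (errorsToGo e pred M u : ℝ) ≤ errorsToGo e pred M t := by
      exact_mod_cast Finset.sum_le_sum_of_subset (Finset.Ico_subset_Ico_left htu)
    linarith
  · intro t ht c x x' φ _ hc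
    obtain ⟨-, h1, -⟩ := predictionError_le_two_mul_scaledError (e := e) (pred := pred) (k := k) t
    rw [costToGo_eq ht, errorsToGo_eq ht]
    push_cast
    linarith
  · intro t ht c x x' φ _ hφ hx' hc m _
    obtain ⟨-, h1, -⟩ := predictionError_le_two_mul_scaledError (e := e) (pred := pred) (k := k) t
    rw [costToGo_eq ht, errorsToGo_eq ht]
    push_cast
    linarith

end Analysis

end AdaSwitch

/-! ### The competitive ratio -/

theorem mainTheorem7 {X : Type*} [MetricSpace X] [Bot X]
    (uniform : ∀ x y : X, x ≠ y → dist x y = 1)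
    {k : ℕ} [NeZero k] (S : Fin k → X) (e pred : ℕ → X)
    (he : AdaSwitch.ConsecutiveFiniteSupport e)
    (hpred : AdaSwitch.ConsecutiveFiniteSupport pred)
    (offline : AdaSwitch.History X (Fin k) → (ℕ → X) → ℕ → Fin k)
    (hoffline : AdaSwitch.IsOfflineOracle S offline)
    (hopt : 0 < (AdaSwitch.kServer S).opt e) :
    (AdaSwitch.kServer S).comp e (AdaSwitch.adaSwitchCA S offline pred) ≤
      1 + min (ENNReal.ofReal (4 * (Real.log k + 1)))
        ((ENNReal.ofReal (56 * k * (Real.log k + 1)) +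
            18 * AdaSwitch.predictionErrors e pred) /
          (AdaSwitch.kServer S).opt e) := by
  open AdaSwitch in
  obtain ⟨M, hM, hM'⟩ := he
  obtain ⟨T, -, hT⟩ := hpred
  have hη := etaCA_ge_two (k := k)
  obtain ⟨D, b, h0, hD, hsum⟩ := exists_follows_optCost_eq e M 0 S
  rw [zero_add] at hD hsum
  have hO : costToGo e D b M 0 = optCost S (segment e 0 M) := hsum
  have hoptE := opt_eq uniform S hM'
  rw [← hO] at hoptE
  have hval := expectedVal_eq_ofReal_value (π := adaSwitchCA S offline pred) (e := e) (kServer S)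
    (c := realCost S) realCost_nonneg
    (fun h x a => by rw [kServer_cost_eq uniform, realCost, ENNReal.ofReal_natCast])
    (M := M) (fun t ht h a => by simp [kServer, hM' t ht])
  -- The planning horizon has to reach beyond the last nonempty prediction and also cover all `M`
  -- requests.
  have hT' : ∀ i, max M T ≤ i → pred i = ⊥ := fun i hi => hT i (le_trans (le_max_right _ _) hi)
  have hrob := (isBound_robust (e := e) (pred := pred) (D := D) (b := b) (M := M)).value_initial_le
    uniform hoffline hM hT' (le_max_left _ _) hD M 0 (zero_add M) [] rfl rfl rfl
  have hcon := (isBound_consistent (e := e) (pred := pred) (D := D) (b := b)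
    (M := M)).value_initial_le
    uniform hoffline hM hT' (le_max_left _ _) hD M 0 (zero_add M) [] rfl rfl rfl
  rw [h0, mismatch_self, Nat.cast_zero, mul_zero, add_zero] at hrob
  have hne0 : (kServer S).opt e ≠ 0 := hopt.ne'
  have hnetop : (kServer S).opt e ≠ ⊤ := by rw [hoptE]; exact ENNReal.natCast_ne_top _
  have hlog : 0 ≤ Real.log k := Real.log_natCast_nonneg k
  rw [OnlineProblem.comp, hval, ← min_add_add_left, le_min_iff]
  constructor
  · refine ENNReal.div_le_of_le_mul ?_
    rw [hoptE, ← ENNReal.ofReal_one, ← ENNReal.ofReal_add zero_le_one (by positivity),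
      ← ENNReal.ofReal_natCast, ← ENNReal.ofReal_mul (by positivity)]
    refine ENNReal.ofReal_le_ofReal (hrob.trans (le_of_eq ?_))
    rw [etaCA]
    ring
  · refine ENNReal.div_le_of_le_mul ?_
    rw [add_mul, one_mul, ENNReal.div_mul_cancel hne0 hnetop]
    have herr : ((errorsToGo e pred M 0 : ℕ) : ENNReal) ≤ predictionErrors e pred := by
      refine le_trans (le_of_eq ?_) (ENNReal.sum_le_tsum (Finset.Ico 0 M))
      rw [errorsToGo, Nat.cast_sum]
      refine Finset.sum_congr rfl fun i _ => ?_
      by_cases hi : e i = pred i <;> simp [predictionError, hi]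
    -- The account gives 20ηk = 40k(ln k + 1) and 14 per error, which leaves slack to 56 and 18.
    calc ENNReal.ofReal _
        ≤ ENNReal.ofReal ((costToGo e D b M 0 : ℝ) +
            (56 * k * (Real.log k + 1) + 18 * errorsToGo e pred M 0)) := by
          refine ENNReal.ofReal_le_ofReal (hcon.trans ?_)
          have h1 : (0 : ℝ) ≤ errorsToGo e pred M 0 := Nat.cast_nonneg _
          have h2 : (0 : ℝ) ≤ k * (Real.log k + 1) := by positivity
          rw [etaCA]
          linarith
      _ = (kServer S).opt e + (ENNReal.ofReal (56 * k * (Real.log k + 1)) +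
            18 * (errorsToGo e pred M 0 : ENNReal)) := by
          rw [ENNReal.ofReal_add (by positivity) (by positivity),
            ENNReal.ofReal_add (by positivity) (by positivity), hoptE, ENNReal.ofReal_natCast,
            show (18 : ℝ) * errorsToGo e pred M 0 = ((18 * errorsToGo e pred M 0 : ℕ) : ℝ) by
              push_cast; rfl, ENNReal.ofReal_natCast]
          push_cast
          rfl
      _ ≤ _ := by gcongr
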